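/- **Theorem 3.1.** A *form* with $k$ free variables ($0\le k\le 9$) is a $3\times3$ matrix $\mathrm L=\mathrm L(x_1,\dots,x_k)$ in which each of the variables $x_1,\dots,x_k$ occupies exactly one slot, different variables occupy different slots, and all remaining slots are $0$. For a $3\times 3$ matrix $\mathrm L$ and $1\le i<j<l\le 6$ let $\mathrm L_{ijl}$ be the $6\times 6$ matrix that carries the entries of $\mathrm L$ at the intersections of rows $i,j,l$ with columns $i,j,l$ and agrees with the identity matrix elsewhere. The local Zamolodchikov tetrahedron equation for the form $\mathrm L$ is $$\mathrm L_{123}(u)\,\mathrm L_{145}(v)\,\mathrm L_{246}(w)\,\mathrm L_{356}(r)=\mathrm L_{356}(t)\,\mathrm L_{246}(z)\,\mathrm L_{145}(y)\,\mathrm L_{123}(x),\qquad x,y,z,t,u,v,w,r\in\mathbb C^k .$$ Call $\mathrm L$ *solvable* if there is a non-zero polynomial $p$ in the $4k$ variables $(x,y,z,t)$ such that for all $(x,y,z,t)\in\mathbb C^{4k}$ with $p(x,y,z,t)\ne0$ the equation has at least one (not necessarily unique) solution $(u,v,w,r)\in\mathbb C^{4k}$, that is, the equation defines a correspondence. Call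 $\mathrm L$ *unsolvable* if there is a non-zero polynomial $p$ such that for all $(x,y,z,t)$ with $p(x,y,z,t)\neq0$ the equation has no solution $(u,v,w,r)\in\mathbb C^{4k}$. Consider the forms $$\mathrm A=\begin{pmatrix}x_1&x_2&0\\x_3&x_4&0\\0&0&x_5\end{pmatrix},\quad \mathrm B=\begin{pmatrix}x_1&x_2&0\\x_3&x_4&x_5\\0&0&0\end{pmatrix},\quad \mathrm C=\begin{pmatrix}0&x_1&0\\x_2&0&x_3\\0&x_4&0\end{pmatrix},\quad \mathrm D=\begin{pmatrix}0&0&0\\x_1&0&0\\0&x_2&x_3\end{pmatrix}.$$ Say that a form is *generated* by another one if it is obtained from it by finitely many of the following operations: reflection of the entries in the antidiagonal; rearranging the variables $x_i$ among themselves; setting a variable $x_i$ to $0$ (the remaining variables being renumbered in order). Then: 1. $\mathrm A$, $\mathrm B$, $\mathrm C$ and $\mathrm D$ are solvable. 2. A form is solvable if and only if it is generated by one of $\mathrm A,\mathrm B,\mathrm C,\mathrm D$. 3. Every form that is generated by none of $\mathrm A,\mathrm B,\mathrm C,\mathrm D$ is unsolvable. 4. None of $\mathrm A,\mathrm B,\mathrm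 C,\mathrm D$ is generated by another one of them. 5. Every form obtained from one of $\mathrm A,\mathrm B,\mathrm C,\mathrm D$ by putting a new free variable in one of its zero slots is unsolvable. -/

import Mathlib

namespace Tetra

open Matrix

/-- A form of a `3 × 3` matrix with `k` free variables `x₁, …, x_k`: the variable `x_{a+1}` stands
in the slot `F a` (row, column), different variables stand in different slots, and all the
remaining slots hold zeros. Rows, columns and variables are counted from `0`. -/
abbrev Form (k : ℕ) : Type := Fin k ↪ Fin 3 × Fin 3

/-- The matrix `L(x₁, …, x_k)` of the given form. -/
def Form.mat {k : ℕ} (F : Form k) (x : Fin k → ℂ) : Matrix (Fin 3) (Fin 3) ℂ :=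
  Matrix.of fun i j => ∑ a : Fin k, if F a = (i, j) then x a else 0

/-- The `6 × 6` extension `L⁶₁₂₃`. -/
def ext123 (L : Matrix (Fin 3) (Fin 3) ℂ) : Matrix (Fin 6) (Fin 6) ℂ :=
  !![L 0 0, L 0 1, L 0 2, 0, 0, 0;
     L 1 0, L 1 1, L 1 2, 0, 0, 0;
     L 2 0, L 2 1, L 2 2, 0, 0, 0;
     0, 0, 0, 1, 0, 0;
     0, 0, 0, 0, 1, 0;
     0, 0, 0, 0, 0, 1]

/-- The `6 × 6` extension `L⁶₁₄₅`. -/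
def ext145 (L : Matrix (Fin 3) (Fin 3) ℂ) : Matrix (Fin 6) (Fin 6) ℂ :=
  !![L 0 0, 0, 0, L 0 1, L 0 2, 0;
     0, 1, 0, 0, 0, 0;
     0, 0, 1, 0, 0, 0;
     L 1 0, 0, 0, L 1 1, L 1 2, 0;
     L 2 0, 0, 0, L 2 1, L 2 2, 0;
     0, 0, 0, 0, 0, 1]

/-- The `6 × 6` extension `L⁶₂₄₆`. -/
def ext246 (L : Matrix (Fin 3) (Fin 3) ℂ) : Matrix (Fin 6) (Fin 6) ℂ :=
  !![1, 0, 0, 0, 0, 0;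
     0, L 0 0, 0, L 0 1, 0, L 0 2;
     0, 0, 1, 0, 0, 0;
     0, L 1 0, 0, L 1 1, 0, L 1 2;
     0, 0, 0, 0, 1, 0;
     0, L 2 0, 0, L 2 1, 0, L 2 2]

/-- The `6 × 6` extension `L⁶₃₅₆`. -/
def ext356 (L : Matrix (Fin 3) (Fin 3) ℂ) : Matrix (Fin 6) (Fin 6) ℂ :=
  !![1, 0, 0, 0, 0, 0;
     0, 1, 0, 0, 0, 0;
     0, 0, L 0 0, 0, L 0 1, L 0 2;
     0, 0, 0, 1, 0, 0;
     0, 0, L 1 0, 0, L 1 1, L 1 2;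
     0, 0, L 2 0, 0, L 2 1, L 2 2]

/-- The local Zamolodchikov tetrahedron equation
`L₁₂₃(u) L₁₄₅(v) L₂₄₆(w) L₃₅₆(r) = L₃₅₆(t) L₂₄₆(z) L₁₄₅(y) L₁₂₃(x)` for matrices of the form `F`. -/
def LocalTetrahedron {k : ℕ} (F : Form k) (x y z t u v w r : Fin k → ℂ) : Prop :=
  ext123 (F.mat u) * ext145 (F.mat v) * ext246 (F.mat w) * ext356 (F.mat r) =
    ext356 (F.mat t) * ext246 (F.mat z) * ext145 (F.mat y) * ext123 (F.mat x)

/-- The polynomial `p` in the `4k` variables `(x, y, z, t)` does not vanish at the given point. -/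
def NonvanishingAt {k : ℕ} (p : MvPolynomial (Fin 4 × Fin k) ℂ) (x y z t : Fin k → ℂ) : Prop :=
  MvPolynomial.eval (fun q : Fin 4 × Fin k => (![x, y, z, t] : Fin 4 → Fin k → ℂ) q.1 q.2) p ≠ 0

/-- The equation can be solved for `(u, v, w, r)`, not necessarily uniquely, when the variables
`(x, y, z, t)` are free, that is, for all of them outside a proper algebraic subset of `ℂ^{4k}`. -/
def Solvable {k : ℕ} (F : Form k) : Prop :=
  ∃ p : MvPolynomial (Fin 4 × Fin k) ℂ, p ≠ 0 ∧ ∀ x y z t : Fin k → ℂ,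
    NonvanishingAt p x y z t → ∃ u v w r : Fin k → ℂ, LocalTetrahedron F x y z t u v w r

/-- The equation has no solution `(u, v, w, r)` when the variables `(x, y, z, t)` are free, that is,
for all of them outside a proper algebraic subset of `ℂ^{4k}`. -/
def Unsolvable {k : ℕ} (F : Form k) : Prop :=
  ∃ p : MvPolynomial (Fin 4 × Fin k) ℂ, p ≠ 0 ∧ ∀ x y z t : Fin k → ℂ,
    NonvanishingAt p x y z t → ¬ ∃ u v w r : Fin k → ℂ, LocalTetrahedron F x y z t u v w r

/-- Reflection in the antidiagonal: slot `(i, j)` goes to slot `(2 - j, 2 - i)`. -/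
def Form.reflect {k : ℕ} (F : Form k) : Form k where
  toFun a := (Fin.rev (F a).2, Fin.rev (F a).1)
  inj' := by
    intro a b h
    apply F.injective
    simp only [Prod.mk.injEq, Fin.rev_inj] at h
    exact Prod.ext h.2 h.1

/-- Rearranging the variables among themselves. -/
def Form.rearrange {k : ℕ} (F : Form k) (s : Equiv.Perm (Fin k)) : Form k where
  toFun a := F (s a)
  inj' := F.injective.comp s.injective

/-- Setting the variable with index `a` to zero (and renumbering the others in order). -/
def Form.setZero {k : ℕ} (F : Form (k + 1)) (a : Fin (k + 1)) : Form k where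
  toFun b := F (a.succAbove b)
  inj' := F.injective.comp Fin.succAbove_right_injective

/-- The forms that arise from `F` by finitely many reflections in the antidiagonal, rearrangements
of the variables, and substitutions of zero for a variable. -/
inductive GeneratedBy {m : ℕ} (F : Form m) : (k : ℕ) → Form k → Prop
  | self : GeneratedBy F m F
  | reflect (k : ℕ) (G : Form k) : GeneratedBy F k G → GeneratedBy F k G.reflect
  | rearrange (k : ℕ) (G : Form k) (s : Equiv.Perm (Fin k)) :
      GeneratedBy F k G → GeneratedBy F k (G.rearrange s)
  | setZero (k : ℕ) (G : Form (k + 1)) (a : Fin (k + 1)) :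
      GeneratedBy F (k + 1) G → GeneratedBy F k (G.setZero a)

/-- `G` is obtained from `F` by putting a new free variable in one of the zero slots of `F`. -/
def AddsVariable {k : ℕ} (F : Form k) (G : Form (k + 1)) : Prop :=
  ∀ a : Fin k, G a.castSucc = F a

/-- `A = (x₁, x₂, 0; x₃, x₄, 0; 0, 0, x₅)`. -/
def formA : Form 5 := ⟨![(0, 0), (0, 1), (1, 0), (1, 1), (2, 2)], by decide⟩

/-- `B = (x₁, x₂, 0; x₃, x₄, x₅; 0, 0, 0)`. -/
def formB : Form 5 := ⟨![(0, 0), (0, 1), (1, 0), (1, 1), (1, 2)], by decide⟩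

/-- `C = (0, x₁, 0; x₂, 0, x₃; 0, x₄, 0)`. -/
def formC : Form 4 := ⟨![(0, 1), (1, 0), (1, 2), (2, 1)], by decide⟩

/-- `D = (0, 0, 0; x₁, 0, 0; 0, x₂, x₃)`. -/
def formD : Form 3 := ⟨![(1, 0), (2, 1), (2, 2)], by decide⟩

/-- The four matrix forms with their numbers of variables: `0, 1, 2, 3` stand for `A, B, C, D`. -/
def fourForms : Fin 4 → (k : ℕ) × Form k :=
  ![⟨5, formA⟩, ⟨5, formB⟩, ⟨4, formC⟩, ⟨3, formD⟩]

end Tetra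

/-!
Whether a form is solvable depends on the set `S` of its occupied slots only. The `512` possible
sets are handled in groups, by two kinds of arguments.

*Unsolvable forms.* Each entry of either side of the equation is a sum over paths, so a minor may
vanish identically on the left-hand side, for the given form, without doing so on the right-hand
side. Then this minor of the right-hand side is a non-zero polynomial in `(x, y, z, t)`, and the
equation has no solution where it does not vanish (`MinorObstruction.unsolvableOn`). Both properties
need only some slots to be occupied and some slots to be empty: the vanishing on the left persists
if variables are set to zero, the non-vanishing on the right persists if variables are added. So
sixteen minors of size at most `3` (the lemmas `minorObstruction_…`) suffice for all the forms that
are not generated by `A, B, C, D`.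

*Solvable forms.* For the forms contained in `A` and `B`, the rows and columns `1, 2, 4` of the
equation form the local Yang–Baxter equation for `2 × 2` matrices, which is solved for each pattern
of zeros of the `2 × 2` block (`yangBaxterSolvableOn`). In the generic case this amounts to the
factorization of a `3 × 3` matrix into three matrices that act on two coordinates each
(`exists_factorization`). What remains of the equation is easily solved. For the forms contained in
`C` and `D` there are explicit solutions.

The reflection in the antidiagonal, combined with the exchange of the lines `1, 6` and `2, 5` and with
transposition, is a symmetry of the equation (`reflect_lhs_eq_rhs`). A form is generated by another
one exactly if its occupied slots, or their reflections, are among those of the other one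
(`generatedBy_iff`). That these groups exhaust all forms is then a finite check
(`subset_or_obstruction`).
-/

namespace Tetra

open Matrix

/-! ### The two sides of the tetrahedron equation, entry by entry -/

/-- The left-hand side of the local tetrahedron equation for four arbitrary matrices. -/
def lhs (U V W R : Matrix (Fin 3) (Fin 3) ℂ) : Matrix (Fin 6) (Fin 6) ℂ :=
  ext123 U * ext145 V * ext246 W * ext356 R

/-- The right-hand side of the local tetrahedron equation for four arbitrary matrices. -/
def rhs (X Y Z T : Matrix (Fin 3) (Fin 3) ℂ) : Matrix (Fin 6) (Fin 6) ℂ :=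
  ext356 T * ext246 Z * ext145 Y * ext123 X

/-- Each entry is a sum over paths: an index is sent along by one factor after the other, and is
left alone by the factors that do not act on it. -/
theorem lhs_eq (U V W R : Matrix (Fin 3) (Fin 3) ℂ) : lhs U V W R =
    !![U 0 0 * V 0 0, U 0 0 * V 0 1 * W 1 0 + U 0 1 * W 0 0, U 0 0 * V 0 1 * W 1 2 * R 2 0 +
       U 0 0 * V 0 2 * R 1 0 + U 0 1 * W 0 2 * R 2 0 + U 0 2 * R 0 0, U 0 0 * V 0 1 * W 1 1 +
       U 0 1 * W 0 1, U 0 0 * V 0 1 * W 1 2 * R 2 1 + U 0 0 * V 0 2 * R 1 1 +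
       U 0 1 * W 0 2 * R 2 1 + U 0 2 * R 0 1, U 0 0 * V 0 1 * W 1 2 * R 2 2 +
       U 0 0 * V 0 2 * R 1 2 + U 0 1 * W 0 2 * R 2 2 + U 0 2 * R 0 2;
      U 1 0 * V 0 0, U 1 0 * V 0 1 * W 1 0 + U 1 1 * W 0 0, U 1 0 * V 0 1 * W 1 2 * R 2 0 +
       U 1 0 * V 0 2 * R 1 0 + U 1 1 * W 0 2 * R 2 0 + U 1 2 * R 0 0, U 1 0 * V 0 1 * W 1 1 +
       U 1 1 * W 0 1, U 1 0 * V 0 1 * W 1 2 * R 2 1 + U 1 0 * V 0 2 * R 1 1 +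
       U 1 1 * W 0 2 * R 2 1 + U 1 2 * R 0 1, U 1 0 * V 0 1 * W 1 2 * R 2 2 +
       U 1 0 * V 0 2 * R 1 2 + U 1 1 * W 0 2 * R 2 2 + U 1 2 * R 0 2;
      U 2 0 * V 0 0, U 2 0 * V 0 1 * W 1 0 + U 2 1 * W 0 0, U 2 0 * V 0 1 * W 1 2 * R 2 0 +
       U 2 0 * V 0 2 * R 1 0 + U 2 1 * W 0 2 * R 2 0 + U 2 2 * R 0 0, U 2 0 * V 0 1 * W 1 1 +
       U 2 1 * W 0 1, U 2 0 * V 0 1 * W 1 2 * R 2 1 + U 2 0 * V 0 2 * R 1 1 +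
       U 2 1 * W 0 2 * R 2 1 + U 2 2 * R 0 1, U 2 0 * V 0 1 * W 1 2 * R 2 2 +
       U 2 0 * V 0 2 * R 1 2 + U 2 1 * W 0 2 * R 2 2 + U 2 2 * R 0 2;
      V 1 0, V 1 1 * W 1 0, V 1 1 * W 1 2 * R 2 0 + V 1 2 * R 1 0, V 1 1 * W 1 1,
       V 1 1 * W 1 2 * R 2 1 + V 1 2 * R 1 1, V 1 1 * W 1 2 * R 2 2 + V 1 2 * R 1 2;
      V 2 0, V 2 1 * W 1 0, V 2 1 * W 1 2 * R 2 0 + V 2 2 * R 1 0, V 2 1 * W 1 1,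
       V 2 1 * W 1 2 * R 2 1 + V 2 2 * R 1 1, V 2 1 * W 1 2 * R 2 2 + V 2 2 * R 1 2;
      0, W 2 0, W 2 2 * R 2 0, W 2 1, W 2 2 * R 2 1, W 2 2 * R 2 2] := by
  have h : ext123 U * ext145 V =
      !![U 0 0 * V 0 0, U 0 1, U 0 2, U 0 0 * V 0 1, U 0 0 * V 0 2, 0;
        U 1 0 * V 0 0, U 1 1, U 1 2, U 1 0 * V 0 1, U 1 0 * V 0 2, 0;
        U 2 0 * V 0 0, U 2 1, U 2 2, U 2 0 * V 0 1, U 2 0 * V 0 2, 0;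
        V 1 0, 0, 0, V 1 1, V 1 2, 0;
        V 2 0, 0, 0, V 2 1, V 2 2, 0;
        0, 0, 0, 0, 0, 1] := by
    ext i j
    fin_cases i <;> fin_cases j <;>
      simp [Matrix.mul_apply, Fin.sum_univ_six, ext123, ext145]
  have h' : ext246 W * ext356 R =
      !![1, 0, 0, 0, 0, 0;
        0, W 0 0, W 0 2 * R 2 0, W 0 1, W 0 2 * R 2 1, W 0 2 * R 2 2;
        0, 0, R 0 0, 0, R 0 1, R 0 2;
        0, W 1 0, W 1 2 * R 2 0, W 1 1, W 1 2 * R 2 1, W 1 2 * R 2 2;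
        0, 0, R 1 0, 0, R 1 1, R 1 2;
        0, W 2 0, W 2 2 * R 2 0, W 2 1, W 2 2 * R 2 1, W 2 2 * R 2 2] := by
    ext i j
    fin_cases i <;> fin_cases j <;>
      simp [Matrix.mul_apply, Fin.sum_univ_six, ext246, ext356]
  rw [lhs, Matrix.mul_assoc (ext123 U * ext145 V), h, h']
  ext i j
  fin_cases i <;> fin_cases j <;> simp [Matrix.mul_apply, Fin.sum_univ_six] <;> ring

theorem rhs_eq (X Y Z T : Matrix (Fin 3) (Fin 3) ℂ) : rhs X Y Z T =
    !![Y 0 0 * X 0 0, Y 0 0 * X 0 1, Y 0 0 * X 0 2, Y 0 1, Y 0 2, 0;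
      Z 0 0 * X 1 0 + Z 0 1 * Y 1 0 * X 0 0, Z 0 0 * X 1 1 + Z 0 1 * Y 1 0 * X 0 1,
       Z 0 0 * X 1 2 + Z 0 1 * Y 1 0 * X 0 2, Z 0 1 * Y 1 1, Z 0 1 * Y 1 2, Z 0 2;
      T 0 0 * X 2 0 + T 0 1 * Y 2 0 * X 0 0 + T 0 2 * Z 2 0 * X 1 0 +
       T 0 2 * Z 2 1 * Y 1 0 * X 0 0, T 0 0 * X 2 1 + T 0 1 * Y 2 0 * X 0 1 +
       T 0 2 * Z 2 0 * X 1 1 + T 0 2 * Z 2 1 * Y 1 0 * X 0 1, T 0 0 * X 2 2 +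
       T 0 1 * Y 2 0 * X 0 2 + T 0 2 * Z 2 0 * X 1 2 + T 0 2 * Z 2 1 * Y 1 0 * X 0 2,
       T 0 1 * Y 2 1 + T 0 2 * Z 2 1 * Y 1 1, T 0 1 * Y 2 2 + T 0 2 * Z 2 1 * Y 1 2,
       T 0 2 * Z 2 2;
      Z 1 0 * X 1 0 + Z 1 1 * Y 1 0 * X 0 0, Z 1 0 * X 1 1 + Z 1 1 * Y 1 0 * X 0 1,
       Z 1 0 * X 1 2 + Z 1 1 * Y 1 0 * X 0 2, Z 1 1 * Y 1 1, Z 1 1 * Y 1 2, Z 1 2;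
      T 1 0 * X 2 0 + T 1 1 * Y 2 0 * X 0 0 + T 1 2 * Z 2 0 * X 1 0 +
       T 1 2 * Z 2 1 * Y 1 0 * X 0 0, T 1 0 * X 2 1 + T 1 1 * Y 2 0 * X 0 1 +
       T 1 2 * Z 2 0 * X 1 1 + T 1 2 * Z 2 1 * Y 1 0 * X 0 1, T 1 0 * X 2 2 +
       T 1 1 * Y 2 0 * X 0 2 + T 1 2 * Z 2 0 * X 1 2 + T 1 2 * Z 2 1 * Y 1 0 * X 0 2,
       T 1 1 * Y 2 1 + T 1 2 * Z 2 1 * Y 1 1, T 1 1 * Y 2 2 + T 1 2 * Z 2 1 * Y 1 2,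
       T 1 2 * Z 2 2;
      T 2 0 * X 2 0 + T 2 1 * Y 2 0 * X 0 0 + T 2 2 * Z 2 0 * X 1 0 +
       T 2 2 * Z 2 1 * Y 1 0 * X 0 0, T 2 0 * X 2 1 + T 2 1 * Y 2 0 * X 0 1 +
       T 2 2 * Z 2 0 * X 1 1 + T 2 2 * Z 2 1 * Y 1 0 * X 0 1, T 2 0 * X 2 2 +
       T 2 1 * Y 2 0 * X 0 2 + T 2 2 * Z 2 0 * X 1 2 + T 2 2 * Z 2 1 * Y 1 0 * X 0 2,
       T 2 1 * Y 2 1 + T 2 2 * Z 2 1 * Y 1 1, T 2 1 * Y 2 2 + T 2 2 * Z 2 1 * Y 1 2,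
       T 2 2 * Z 2 2] := by
  have h : ext356 T * ext246 Z =
      !![1, 0, 0, 0, 0, 0;
        0, Z 0 0, 0, Z 0 1, 0, Z 0 2;
        0, T 0 2 * Z 2 0, T 0 0, T 0 2 * Z 2 1, T 0 1, T 0 2 * Z 2 2;
        0, Z 1 0, 0, Z 1 1, 0, Z 1 2;
        0, T 1 2 * Z 2 0, T 1 0, T 1 2 * Z 2 1, T 1 1, T 1 2 * Z 2 2;
        0, T 2 2 * Z 2 0, T 2 0, T 2 2 * Z 2 1, T 2 1, T 2 2 * Z 2 2] := by
    ext i j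
    fin_cases i <;> fin_cases j <;>
      simp [Matrix.mul_apply, Fin.sum_univ_six, ext246, ext356]
  have h' : ext145 Y * ext123 X =
      !![Y 0 0 * X 0 0, Y 0 0 * X 0 1, Y 0 0 * X 0 2, Y 0 1, Y 0 2, 0;
        X 1 0, X 1 1, X 1 2, 0, 0, 0;
        X 2 0, X 2 1, X 2 2, 0, 0, 0;
        Y 1 0 * X 0 0, Y 1 0 * X 0 1, Y 1 0 * X 0 2, Y 1 1, Y 1 2, 0;
        Y 2 0 * X 0 0, Y 2 0 * X 0 1, Y 2 0 * X 0 2, Y 2 1, Y 2 2, 0;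
        0, 0, 0, 0, 0, 1] := by
    ext i j
    fin_cases i <;> fin_cases j <;>
      simp [Matrix.mul_apply, Fin.sum_univ_six, ext123, ext145]
  rw [rhs, Matrix.mul_assoc (ext356 T * ext246 Z), h, h']
  ext i j
  fin_cases i <;> fin_cases j <;> simp [Matrix.mul_apply, Fin.sum_univ_six] <;> ring

/-! ### Polynomial conditions on quadruples of supported matrices -/

/-- The slots, i.e. the positions in a `3 × 3` matrix. -/
abbrev Slot : Type := Fin 3 × Fin 3

/-- The matrix `M` vanishes outside the slots in `S`. -/
def SupportedOn (S : Finset Slot) (M : Matrix (Fin 3) (Fin 3) ℂ) : Prop :=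
  ∀ i j, (i, j) ∉ S → M i j = 0

/-- A function of four `3 × 3` matrices that is a polynomial in their entries. -/
def IsPolynomialFun (f : (Fin 4 → Matrix (Fin 3) (Fin 3) ℂ) → ℂ) : Prop :=
  ∃ P : MvPolynomial (Fin 4 × Slot) ℂ,
    ∀ M, MvPolynomial.eval (fun q => M q.1 q.2.1 q.2.2) P = f M

namespace IsPolynomialFun

variable {f g : (Fin 4 → Matrix (Fin 3) (Fin 3) ℂ) → ℂ}

theorem const (c : ℂ) : IsPolynomialFun fun _ => c :=
  ⟨MvPolynomial.C c, fun _ => by simp⟩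

theorem entry (q : Fin 4) (i j : Fin 3) : IsPolynomialFun fun M => M q i j :=
  ⟨MvPolynomial.X (q, (i, j)), fun _ => by simp⟩

theorem add (hf : IsPolynomialFun f) (hg : IsPolynomialFun g) :
    IsPolynomialFun fun M => f M + g M := by
  obtain ⟨P, hP⟩ := hf
  obtain ⟨Q, hQ⟩ := hg
  exact ⟨P + Q, fun M => by simp [hP, hQ]⟩

theorem mul (hf : IsPolynomialFun f) (hg : IsPolynomialFun g) :
    IsPolynomialFun fun M => f M * g M := by
  obtain ⟨P, hP⟩ := hf
  obtain ⟨Q, hQ⟩ := hg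
  exact ⟨P * Q, fun M => by simp [hP, hQ]⟩

theorem sub (hf : IsPolynomialFun f) (hg : IsPolynomialFun g) :
    IsPolynomialFun fun M => f M - g M := by
  obtain ⟨P, hP⟩ := hf
  obtain ⟨Q, hQ⟩ := hg
  exact ⟨P - Q, fun M => by simp [hP, hQ]⟩

theorem sum {ι : Type*} (s : Finset ι) {f : ι → (Fin 4 → Matrix (Fin 3) (Fin 3) ℂ) → ℂ}
    (hf : ∀ i, IsPolynomialFun (f i)) : IsPolynomialFun fun M => ∑ i ∈ s, f i M := by
  choose P hP using hf
  exact ⟨∑ i ∈ s, P i, fun M => by simp [hP]⟩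

theorem prod {ι : Type*} (s : Finset ι) {f : ι → (Fin 4 → Matrix (Fin 3) (Fin 3) ℂ) → ℂ}
    (hf : ∀ i, IsPolynomialFun (f i)) : IsPolynomialFun fun M => ∏ i ∈ s, f i M := by
  choose P hP using hf
  exact ⟨∏ i ∈ s, P i, fun M => by simp [hP]⟩

theorem det {n : ℕ} {A : (Fin 4 → Matrix (Fin 3) (Fin 3) ℂ) → Matrix (Fin n) (Fin n) ℂ}
    (hA : ∀ i j, IsPolynomialFun fun M => A M i j) : IsPolynomialFun fun M => (A M).det := by
  simp only [Matrix.det_apply']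
  exact sum _ fun σ => (const _).mul (prod _ fun i => hA _ _)

theorem rhs_entry (i j : Fin 6) :
    IsPolynomialFun fun M => rhs (M 0) (M 1) (M 2) (M 3) i j := by
  simp only [rhs_eq]
  fin_cases i <;> fin_cases j <;> simp <;>
    repeat' first | exact const _ | exact entry _ _ _ | apply mul | apply add

end IsPolynomialFun

/-- The equation can be solved by matrices supported on `S` when its right-hand side is built from
matrices supported on `S` at which a certain polynomial does not vanish. -/
def SolvableOn (S : Finset Slot) : Prop :=
  ∃ f, IsPolynomialFun f ∧ (∃ M, (∀ q, SupportedOn S (M q)) ∧ f M ≠ 0) ∧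
    ∀ M, (∀ q, SupportedOn S (M q)) → f M ≠ 0 →
      ∃ U V W R, SupportedOn S U ∧ SupportedOn S V ∧ SupportedOn S W ∧ SupportedOn S R ∧
        lhs U V W R = rhs (M 0) (M 1) (M 2) (M 3)

/-- The equation cannot be solved by matrices supported on `S` when its right-hand side is built
from matrices supported on `S` at which a certain polynomial does not vanish. -/
def UnsolvableOn (S : Finset Slot) : Prop :=
  ∃ f, IsPolynomialFun f ∧ (∃ M, (∀ q, SupportedOn S (M q)) ∧ f M ≠ 0) ∧
    ∀ M, (∀ q, SupportedOn S (M q)) → f M ≠ 0 →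
      ¬ ∃ U V W R, SupportedOn S U ∧ SupportedOn S V ∧ SupportedOn S W ∧ SupportedOn S R ∧
        lhs U V W R = rhs (M 0) (M 1) (M 2) (M 3)

/-! ### Solvability of a form depends on its occupied slots only -/

/-- The slots that are occupied by the variables of a form. -/
def Form.slots {k : ℕ} (F : Form k) : Finset Slot := Finset.univ.map F

theorem Form.mem_slots {k : ℕ} {F : Form k} {s : Slot} : s ∈ F.slots ↔ ∃ a, F a = s := by
  simp [Form.slots]

theorem Form.mat_slot {k : ℕ} (F : Form k) (x : Fin k → ℂ) (a : Fin k) :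
    F.mat x (F a).1 (F a).2 = x a := by
  simp [Form.mat, F.injective.eq_iff]

theorem Form.mat_supportedOn {k : ℕ} (F : Form k) (x : Fin k → ℂ) :
    SupportedOn F.slots (F.mat x) := by
  intro i j hij
  rw [Form.mat, Matrix.of_apply]
  exact Finset.sum_eq_zero fun a _ => if_neg fun h => hij (Form.mem_slots.2 ⟨a, h⟩)

theorem Form.mat_entries {k : ℕ} (F : Form k) {M : Matrix (Fin 3) (Fin 3) ℂ}
    (hM : SupportedOn F.slots M) : F.mat (fun a => M (F a).1 (F a).2) = M := by
  ext i j
  by_cases h : (i, j) ∈ F.slots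
  · obtain ⟨a, ha⟩ := Form.mem_slots.1 h
    have := F.mat_slot (fun a => M (F a).1 (F a).2) a
    simpa only [ha] using this
  · rw [F.mat_supportedOn _ i j h, hM i j h]

/-- A polynomial in the matrix entries turns into a polynomial in the variables of the form; it is
non-zero if it does not vanish at some matrices of that form. -/
theorem IsPolynomialFun.exists_polynomial {k : ℕ} (F : Form k)
    {f : (Fin 4 → Matrix (Fin 3) (Fin 3) ℂ) → ℂ} (hf : IsPolynomialFun f)
    (hM : ∃ M, (∀ q, SupportedOn F.slots (M q)) ∧ f M ≠ 0) :
    ∃ p : MvPolynomial (Fin 4 × Fin k) ℂ, p ≠ 0 ∧ ∀ x y z t : Fin k → ℂ,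
      NonvanishingAt p x y z t → f ![F.mat x, F.mat y, F.mat z, F.mat t] ≠ 0 := by
  obtain ⟨P, hP⟩ := hf
  let σ : Fin 4 × Slot → MvPolynomial (Fin 4 × Fin k) ℂ := fun q =>
    ∑ a : Fin k, if F a = q.2 then MvPolynomial.X (q.1, a) else 0
  have key : ∀ v : Fin 4 → Fin k → ℂ,
      MvPolynomial.eval (fun q : Fin 4 × Fin k => v q.1 q.2) (MvPolynomial.bind₁ σ P) =
        f fun q => F.mat (v q) := by
    intro v
    rw [← hP, MvPolynomial.eval, MvPolynomial.eval₂Hom_bind₁]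
    congr 2
    ext q
    simp [σ, Form.mat, apply_ite]
  refine ⟨MvPolynomial.bind₁ σ P, ?_, ?_⟩
  · rintro h0
    obtain ⟨M, hS, hM⟩ := hM
    apply hM
    have h := key fun q a => M q (F a).1 (F a).2
    rw [h0, map_zero] at h
    simp only [F.mat_entries (hS _)] at h
    exact h.symm
  · intro x y z t h
    rw [NonvanishingAt, key] at h
    convert h using 2
    ext q
    fin_cases q <;> rfl

theorem SolvableOn.solvable {k : ℕ} {F : Form k} (h : SolvableOn F.slots) : Solvable F := by
  obtain ⟨f, hf, hM, h⟩ := h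
  obtain ⟨p, hp, hpf⟩ := hf.exists_polynomial F hM
  refine ⟨p, hp, fun x y z t hn => ?_⟩
  obtain ⟨U, V, W, R, hU, hV, hW, hR, he⟩ := h _
    (by intro q; fin_cases q <;> exact F.mat_supportedOn _) (hpf x y z t hn)
  refine ⟨fun a => U (F a).1 (F a).2, fun a => V (F a).1 (F a).2, fun a => W (F a).1 (F a).2,
    fun a => R (F a).1 (F a).2, ?_⟩
  simp only [LocalTetrahedron, F.mat_entries hU, F.mat_entries hV, F.mat_entries hW,
    F.mat_entries hR]
  exact he

theorem UnsolvableOn.unsolvable {k : ℕ} {F : Form k} (h : UnsolvableOn F.slots) :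
    Unsolvable F := by
  obtain ⟨f, hf, hM, h⟩ := h
  obtain ⟨p, hp, hpf⟩ := hf.exists_polynomial F hM
  refine ⟨p, hp, fun x y z t hn => ?_⟩
  rintro ⟨u, v, w, r, he⟩
  exact h _ (by intro q; fin_cases q <;> exact F.mat_supportedOn _) (hpf x y z t hn)
    ⟨_, _, _, _, F.mat_supportedOn u, F.mat_supportedOn v, F.mat_supportedOn w,
      F.mat_supportedOn r, he⟩

/-- Two non-zero polynomials over `ℂ` have a common point of non-vanishing. -/
theorem Unsolvable.not_solvable {k : ℕ} {F : Form k} (h : Unsolvable F) : ¬ Solvable F := by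
  rintro ⟨p, hp, hs⟩
  obtain ⟨p', hp', hu⟩ := h
  have hne : p * p' ≠ 0 := mul_ne_zero hp hp'
  obtain ⟨v, hv⟩ : ∃ v, MvPolynomial.eval v (p * p') ≠ 0 := by
    by_contra! h0
    exact hne (MvPolynomial.funext fun v => by rw [h0, map_zero])
  rw [map_mul] at hv
  have hv' : (fun q : Fin 4 × Fin k => (![fun a => v (0, a), fun a => v (1, a),
      fun a => v (2, a), fun a => v (3, a)] : Fin 4 → Fin k → ℂ) q.1 q.2) = v := by
    ext ⟨q, a⟩
    fin_cases q <;> rfl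
  refine hu (fun a => v (0, a)) (fun a => v (1, a)) (fun a => v (2, a)) (fun a => v (3, a)) ?_
    (hs _ _ _ _ ?_)
  · rw [NonvanishingAt, hv']
    exact right_ne_zero_of_mul hv
  · rw [NonvanishingAt, hv']
    exact left_ne_zero_of_mul hv

/-! ### Reflection in the antidiagonal -/

/-- Reflection of a set of slots in the antidiagonal. -/
def reflectSlots (S : Finset Slot) : Finset Slot :=
  S.image fun s => (Fin.rev s.2, Fin.rev s.1)

/-- Reflection of a matrix in the antidiagonal. -/
def reflectMat (M : Matrix (Fin 3) (Fin 3) ℂ) : Matrix (Fin 3) (Fin 3) ℂ :=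
  Matrix.of fun i j => M (Fin.rev j) (Fin.rev i)

theorem reflectMat_eq (M : Matrix (Fin 3) (Fin 3) ℂ) :
    reflectMat M = !![M 2 2, M 1 2, M 0 2; M 2 1, M 1 1, M 0 1; M 2 0, M 1 0, M 0 0] := by
  ext i j
  fin_cases i <;> fin_cases j <;> rfl

theorem reflectMat_reflectMat (M : Matrix (Fin 3) (Fin 3) ℂ) :
    reflectMat (reflectMat M) = M := by
  ext i j
  simp [reflectMat]

theorem reflectSlots_reflectSlots (S : Finset Slot) : reflectSlots (reflectSlots S) = S := by
  simp [reflectSlots, Finset.image_image, Function.comp_def]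

theorem Form.slots_reflect {k : ℕ} (F : Form k) : F.reflect.slots = reflectSlots F.slots := by
  ext s
  simp only [reflectSlots, Form.mem_slots, Finset.mem_image, exists_exists_eq_and]
  rfl

theorem Form.reflect_reflect {k : ℕ} (F : Form k) : F.reflect.reflect = F := by
  refine DFunLike.ext _ _ fun a => ?_
  change (Fin.rev (Fin.rev (F a).1), Fin.rev (Fin.rev (F a).2)) = F a
  simp

theorem SupportedOn.reflect {S : Finset Slot} {M : Matrix (Fin 3) (Fin 3) ℂ}
    (h : SupportedOn S M) : SupportedOn (reflectSlots S) (reflectMat M) := by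
  intro i j hij
  refine h _ _ fun hS => hij ?_
  exact Finset.mem_image.2 ⟨_, hS, by simp⟩

/-- The permutation of the six lines that exchanges `1, 6` and `2, 5`, combined with transposition,
exchanges the index triples `123`, `356` and the index triples `145`, `246`, and reverses products.
So it turns a solution of the equation into a solution of the reflected equation. -/
theorem reflect_lhs_eq_rhs {U V W R X Y Z T : Matrix (Fin 3) (Fin 3) ℂ}
    (h : lhs U V W R = rhs X Y Z T) :
    lhs (reflectMat R) (reflectMat W) (reflectMat V) (reflectMat U) =
      rhs (reflectMat T) (reflectMat Z) (reflectMat Y) (reflectMat X) := by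
  let e : Equiv.Perm (Fin 6) :=
    ⟨![5, 4, 2, 3, 1, 0], ![5, 4, 2, 3, 1, 0], by decide, by decide⟩
  have h123 : ∀ L, ext123 (reflectMat L) = (ext356 L)ᵀ.submatrix e e := by
    intro L
    ext i j
    fin_cases i <;> fin_cases j <;> simp [ext123, ext356, reflectMat_eq, e]
  have h145 : ∀ L, ext145 (reflectMat L) = (ext246 L)ᵀ.submatrix e e := by
    intro L
    ext i j
    fin_cases i <;> fin_cases j <;> simp [ext145, ext246, reflectMat_eq, e]
  have h246 : ∀ L, ext246 (reflectMat L) = (ext145 L)ᵀ.submatrix e e := by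
    intro L
    ext i j
    fin_cases i <;> fin_cases j <;> simp [ext246, ext145, reflectMat_eq, e]
  have h356 : ∀ L, ext356 (reflectMat L) = (ext123 L)ᵀ.submatrix e e := by
    intro L
    ext i j
    fin_cases i <;> fin_cases j <;> simp [ext356, ext123, reflectMat_eq, e]
  have h' := congrArg (fun A => Aᵀ.submatrix e e) h
  simp only [lhs, rhs, h123, h145, h246, h356, Matrix.submatrix_mul_equiv,
    ← Matrix.transpose_mul, Matrix.mul_assoc] at h' ⊢
  exact h'

theorem IsPolynomialFun.reflect {f : (Fin 4 → Matrix (Fin 3) (Fin 3) ℂ) → ℂ}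
    (hf : IsPolynomialFun f) : IsPolynomialFun fun M => f fun q => reflectMat (M (Fin.rev q)) := by
  obtain ⟨P, hP⟩ := hf
  refine ⟨MvPolynomial.rename (fun q => (Fin.rev q.1, (Fin.rev q.2.2, Fin.rev q.2.1))) P,
    fun M => ?_⟩
  rw [MvPolynomial.eval_rename]
  exact hP fun q => reflectMat (M (Fin.rev q))

theorem SolvableOn.reflect {S : Finset Slot} (h : SolvableOn S) :
    SolvableOn (reflectSlots S) := by
  obtain ⟨f, hf, ⟨M, hS, hM⟩, h⟩ := h
  refine ⟨_, hf.reflect, ⟨fun q => reflectMat (M (Fin.rev q)), fun q => (hS _).reflect, ?_⟩, ?_⟩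
  · simpa [reflectMat_reflectMat] using hM
  · intro N hN hfN
    obtain ⟨U, V, W, R, hU, hV, hW, hR, he⟩ := h _
      (fun q => by simpa [reflectSlots_reflectSlots] using (hN (Fin.rev q)).reflect) hfN
    refine ⟨_, _, _, _, hR.reflect, hW.reflect, hV.reflect, hU.reflect, ?_⟩
    rw [reflect_lhs_eq_rhs he]
    simp only [reflectMat_reflectMat]
    rfl

theorem UnsolvableOn.reflect {S : Finset Slot} (h : UnsolvableOn S) :
    UnsolvableOn (reflectSlots S) := by
  obtain ⟨f, hf, ⟨M, hS, hM⟩, h⟩ := h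
  refine ⟨_, hf.reflect, ⟨fun q => reflectMat (M (Fin.rev q)), fun q => (hS _).reflect, ?_⟩, ?_⟩
  · simpa [reflectMat_reflectMat] using hM
  · rintro N hN hfN ⟨U, V, W, R, hU, hV, hW, hR, he⟩
    refine h _ (fun q => by simpa [reflectSlots_reflectSlots] using (hN (Fin.rev q)).reflect) hfN
      ⟨reflectMat R, reflectMat W, reflectMat V, reflectMat U, ?_, ?_, ?_, ?_,
        reflect_lhs_eq_rhs he⟩
    all_goals rw [← reflectSlots_reflectSlots S]
    exacts [hR.reflect, hW.reflect, hV.reflect, hU.reflect]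

/-! ### The generated forms -/

theorem GeneratedBy.slots_subset {m : ℕ} {F : Form m} {k : ℕ} {G : Form k}
    (h : GeneratedBy F k G) : G.slots ⊆ F.slots ∨ G.slots ⊆ reflectSlots F.slots := by
  induction h with
  | self => exact Or.inl subset_rfl
  | reflect k G _ ih =>
    rw [Form.slots_reflect]
    refine ih.symm.imp (fun h => ?_) fun h => Finset.image_subset_image h
    rw [← reflectSlots_reflectSlots F.slots]
    exact Finset.image_subset_image h
  | rearrange k G s _ ih =>
    have : (G.rearrange s).slots ⊆ G.slots := by
      intro q hq
      obtain ⟨a, rfl⟩ := Form.mem_slots.1 hq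
      exact Form.mem_slots.2 ⟨s a, rfl⟩
    exact ih.imp this.trans this.trans
  | setZero k G b _ ih =>
    have : (G.setZero b).slots ⊆ G.slots := by
      intro q hq
      obtain ⟨a, rfl⟩ := Form.mem_slots.1 hq
      exact Form.mem_slots.2 ⟨b.succAbove a, rfl⟩
    exact ih.imp this.trans this.trans

/-- Selecting some of the variables of a form, in any order: the missing variables are put back one
by one at the end of the list, until all of them are there, in some order. -/
theorem generatedBy_trans_embedding {m : ℕ} (F : Form m) (d : ℕ) :
    ∀ (k : ℕ) (e : Fin k ↪ Fin m), k + d = m → GeneratedBy F k (e.trans F) := by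
  induction d with
  | zero =>
    rintro k e rfl
    exact GeneratedBy.rearrange _ F
      (Equiv.ofBijective e (Finite.injective_iff_bijective.1 e.injective)) GeneratedBy.self
  | succ d ih =>
    intro k e hk
    obtain ⟨b, hb⟩ : ∃ b, b ∉ Set.range e := by
      by_contra! h
      have := Fintype.card_le_of_surjective e h
      simp at this
      omega
    have hinj : Function.Injective (Fin.snoc e b : Fin (k + 1) → Fin m) :=
      Fin.snoc_injective_iff.2 ⟨e.injective, hb⟩
    have := GeneratedBy.setZero k _ (Fin.last k) (ih (k + 1) ⟨_, hinj⟩ (by omega))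
    convert this using 1
    ext a <;> simp [Form.setZero]

theorem generatedBy_of_slots_subset {m k : ℕ} {F : Form m} {G : Form k}
    (h : G.slots ⊆ F.slots) : GeneratedBy F k G := by
  have h' : ∀ a, ∃ b, F b = G a := fun a => Form.mem_slots.1 (h (Form.mem_slots.2 ⟨a, rfl⟩))
  choose e he using h'
  have hinj : Function.Injective e := fun a b hab => G.injective (by rw [← he, ← he, hab])
  have hk : k ≤ m := by simpa using Fintype.card_le_of_injective e hinj
  have := generatedBy_trans_embedding F (m - k) k ⟨e, hinj⟩ (by omega)
  convert this using 1
  ext a <;> simp [he]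

theorem generatedBy_iff {m k : ℕ} {F : Form m} {G : Form k} :
    GeneratedBy F k G ↔ G.slots ⊆ F.slots ∨ G.slots ⊆ reflectSlots F.slots := by
  refine ⟨GeneratedBy.slots_subset, ?_⟩
  rintro (h | h)
  · exact generatedBy_of_slots_subset h
  · rw [← G.reflect_reflect]
    refine GeneratedBy.reflect _ _ (generatedBy_of_slots_subset ?_)
    rw [Form.slots_reflect, ← reflectSlots_reflectSlots F.slots]
    exact Finset.image_subset_image h

/-! ### Unsolvable forms: minors that vanish on the left-hand side only -/

/-- The minor of the equation with rows `I` and columns `J` is an obstruction for all forms in which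
the slots in `Q` are occupied and the slots in `N` are empty: on the left-hand side it vanishes as
soon as the slots in `N` are empty, but on the right-hand side it does not vanish identically, even
if only the slots in `Q` are occupied. -/
def MinorObstruction {n : ℕ} (I J : Fin n → Fin 6) (Q N : Finset Slot) : Prop :=
  (∀ U V W R : Matrix (Fin 3) (Fin 3) ℂ, (∀ s ∈ N, U s.1 s.2 = 0) → (∀ s ∈ N, V s.1 s.2 = 0) →
    (∀ s ∈ N, W s.1 s.2 = 0) → (∀ s ∈ N, R s.1 s.2 = 0) →
      ((lhs U V W R).submatrix I J).det = 0) ∧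
  ∃ X Y Z T, SupportedOn Q X ∧ SupportedOn Q Y ∧ SupportedOn Q Z ∧ SupportedOn Q T ∧
    ((rhs X Y Z T).submatrix I J).det ≠ 0

theorem SupportedOn.mono {S S' : Finset Slot} (hS : S ⊆ S') {M : Matrix (Fin 3) (Fin 3) ℂ}
    (h : SupportedOn S M) : SupportedOn S' M :=
  fun i j hij => h i j fun h' => hij (hS h')

theorem MinorObstruction.unsolvableOn {n : ℕ} {I J : Fin n → Fin 6} {Q N S : Finset Slot}
    (h : MinorObstruction I J Q N) (hQ : Q ⊆ S) (hN : Disjoint N S) : UnsolvableOn S := by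
  obtain ⟨hl, X, Y, Z, T, hX, hY, hZ, hT, hr⟩ := h
  refine ⟨fun M => ((rhs (M 0) (M 1) (M 2) (M 3)).submatrix I J).det,
    IsPolynomialFun.det fun i j => IsPolynomialFun.rhs_entry (I i) (J j), ⟨![X, Y, Z, T], ?_, hr⟩,
    ?_⟩
  · intro q
    fin_cases q
    exacts [hX.mono hQ, hY.mono hQ, hZ.mono hQ, hT.mono hQ]
  · rintro M - hM ⟨U, V, W, R, hU, hV, hW, hR, he⟩
    have hv : ∀ {L}, SupportedOn S L → ∀ s ∈ N, L s.1 s.2 = 0 := fun hL s hs =>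
      hL _ _ (Finset.disjoint_left.1 hN hs)
    refine hM ?_
    simp only [← he]
    exact hl U V W R (hv hU) (hv hV) (hv hW) (hv hR)

theorem supportedOn_zero (S : Finset Slot) : SupportedOn S 0 := fun _ _ _ => rfl

theorem supportedOn_single {S : Finset Slot} {a b : Fin 3} (h : (a, b) ∈ S) :
    SupportedOn S (single a b 1) := by
  intro i j hij
  rw [single_apply, if_neg]
  rintro ⟨rfl, rfl⟩
  exact hij h

theorem SupportedOn.add {S : Finset Slot} {M N : Matrix (Fin 3) (Fin 3) ℂ}
    (hM : SupportedOn S M) (hN : SupportedOn S N) : SupportedOn S (M + N) := fun i j h => by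
  rw [Matrix.add_apply, hM i j h, hN i j h, add_zero]

/-- In this lemma and the similar ones below, the name gives the rows and the columns of the minor,
counted from `1`. The matrices for the right-hand side have few non-zero entries, and the minor takes
the value `1` or `-1` at them. -/
theorem minorObstruction_1_5 :
    MinorObstruction ![0] ![4] {(0, 2)}
      {(0, 0), (0, 1)} := by
  refine ⟨fun U V W R hU hV hW hR => ?_,
    0, single 0 2 1, 0, 0,
    supportedOn_zero _,
    supportedOn_single (by decide),
    supportedOn_zero _,
    supportedOn_zero _, ?_⟩
  · simp only [Finset.forall_mem_insert, Finset.mem_singleton, forall_eq] at hU hV hW hR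
    rw [det_fin_one]
    simp [lhs_eq, hU, hV, hW, hR]
  · rw [det_fin_one]
    simp [rhs_eq]

theorem minorObstruction_1_5' :
    MinorObstruction ![0] ![4] {(0, 2)}
      {(0, 1), (1, 1)} := by
  refine ⟨fun U V W R hU hV hW hR => ?_,
    0, single 0 2 1, 0, 0,
    supportedOn_zero _,
    supportedOn_single (by decide),
    supportedOn_zero _,
    supportedOn_zero _, ?_⟩
  · simp only [Finset.forall_mem_insert, Finset.mem_singleton, forall_eq] at hU hV hW hR
    rw [det_fin_one]
    simp [lhs_eq, hU, hV, hW, hR]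
  · rw [det_fin_one]
    simp [rhs_eq]

theorem minorObstruction_3_4 :
    MinorObstruction ![2] ![3] {(0, 2), (1, 1), (2, 1)}
      {(0, 1)} := by
  refine ⟨fun U V W R hU hV hW hR => ?_,
    0, single 1 1 1, single 2 1 1, single 0 2 1,
    supportedOn_zero _,
    supportedOn_single (by decide),
    supportedOn_single (by decide),
    supportedOn_single (by decide), ?_⟩
  · simp only [Finset.mem_singleton, forall_eq] at hU hV hW hR
    rw [det_fin_one]
    simp [lhs_eq, hU, hV, hW, hR]
  · rw [det_fin_one]
    simp [rhs_eq]

theorem minorObstruction_5_3 :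
    MinorObstruction ![4] ![2] {(0, 2), (1, 0), (1, 2), (2, 1)}
      {(2, 0), (2, 2)} := by
  refine ⟨fun U V W R hU hV hW hR => ?_,
    single 0 2 1, single 1 0 1, single 2 1 1, single 1 2 1,
    supportedOn_single (by decide),
    supportedOn_single (by decide),
    supportedOn_single (by decide),
    supportedOn_single (by decide), ?_⟩
  · simp only [Finset.forall_mem_insert, Finset.mem_singleton, forall_eq] at hU hV hW hR
    rw [det_fin_one]
    simp [lhs_eq, hU, hV, hW, hR]
  · rw [det_fin_one]
    simp [rhs_eq]

theorem minorObstruction_6_1 :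
    MinorObstruction ![5] ![0] {(2, 0)}
      ∅ := by
  refine ⟨fun U V W R hU hV hW hR => ?_,
    single 2 0 1, 0, 0, single 2 0 1,
    supportedOn_single (by decide),
    supportedOn_zero _,
    supportedOn_zero _,
    supportedOn_single (by decide), ?_⟩
  · rw [det_fin_one]
    simp [lhs_eq]
  · rw [det_fin_one]
    simp [rhs_eq]

theorem minorObstruction_6_1' :
    MinorObstruction ![5] ![0] {(0, 0), (1, 0), (2, 1), (2, 2)}
      ∅ := by
  refine ⟨fun U V W R hU hV hW hR => ?_,
    single 0 0 1, single 1 0 1, single 2 1 1, single 2 2 1,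
    supportedOn_single (by decide),
    supportedOn_single (by decide),
    supportedOn_single (by decide),
    supportedOn_single (by decide), ?_⟩
  · rw [det_fin_one]
    simp [lhs_eq]
  · rw [det_fin_one]
    simp [rhs_eq]

theorem minorObstruction_6_2 :
    MinorObstruction ![5] ![1] {(0, 1), (1, 0), (2, 1), (2, 2)}
      {(2, 0)} := by
  refine ⟨fun U V W R hU hV hW hR => ?_,
    single 0 1 1, single 1 0 1, single 2 1 1, single 2 2 1,
    supportedOn_single (by decide),
    supportedOn_single (by decide),
    supportedOn_single (by decide),
    supportedOn_single (by decide), ?_⟩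
  · simp only [Finset.mem_singleton, forall_eq] at hU hV hW hR
    rw [det_fin_one]
    simp [lhs_eq, hU, hV, hW, hR]
  · rw [det_fin_one]
    simp [rhs_eq]

theorem minorObstruction_12_56 :
    MinorObstruction ![0, 1] ![4, 5] {(0, 2)}
      {(0, 0), (1, 0), (2, 1), (2, 2)} := by
  refine ⟨fun U V W R hU hV hW hR => ?_,
    0, single 0 2 1, single 0 2 1, 0,
    supportedOn_zero _,
    supportedOn_single (by decide),
    supportedOn_single (by decide),
    supportedOn_zero _, ?_⟩
  · simp only [Finset.forall_mem_insert, Finset.mem_singleton, forall_eq] at hU hV hW hR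
    rw [det_fin_two]
    simp [lhs_eq, hU, hV, hW, hR]
    ring
  · rw [det_fin_two]
    simp [rhs_eq]

theorem minorObstruction_13_24 :
    MinorObstruction ![0, 2] ![1, 3] {(0, 0), (0, 1), (2, 1)}
      {(1, 0), (1, 1)} := by
  refine ⟨fun U V W R hU hV hW hR => ?_,
    single 2 1 1, single 0 1 1, 0, single 0 0 1,
    supportedOn_single (by decide),
    supportedOn_single (by decide),
    supportedOn_zero _,
    supportedOn_single (by decide), ?_⟩
  · simp only [Finset.forall_mem_insert, Finset.mem_singleton, forall_eq] at hU hV hW hR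
    rw [det_fin_two]
    simp [lhs_eq, hU, hV, hW, hR]
    ring
  · rw [det_fin_two]
    simp [rhs_eq]

theorem minorObstruction_23_35 :
    MinorObstruction ![1, 2] ![2, 4] {(0, 0), (0, 1), (1, 2), (2, 2)}
      {(1, 0), (2, 0), (2, 1)} := by
  refine ⟨fun U V W R hU hV hW hR => ?_,
    single 1 2 1, single 2 2 1, single 0 0 1, single 0 1 1,
    supportedOn_single (by decide),
    supportedOn_single (by decide),
    supportedOn_single (by decide),
    supportedOn_single (by decide), ?_⟩
  · simp only [Finset.forall_mem_insert, Finset.mem_singleton, forall_eq] at hU hV hW hR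
    rw [det_fin_two]
    simp [lhs_eq, hU, hV, hW, hR]
    ring
  · rw [det_fin_two]
    simp [rhs_eq]

theorem minorObstruction_45_24 :
    MinorObstruction ![3, 4] ![1, 3] {(1, 0), (1, 1), (2, 1)}
      ∅ := by
  refine ⟨fun U V W R hU hV hW hR => ?_,
    single 2 1 1, single 1 1 1, single 1 1 1, single 1 0 1,
    supportedOn_single (by decide),
    supportedOn_single (by decide),
    supportedOn_single (by decide),
    supportedOn_single (by decide), ?_⟩
  · rw [det_fin_two]
    simp [lhs_eq]
    ring
  · rw [det_fin_two]
    simp [rhs_eq]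

theorem minorObstruction_45_35 :
    MinorObstruction ![3, 4] ![2, 4] {(1, 0), (1, 1), (1, 2), (2, 2)}
      {(2, 0), (2, 1)} := by
  refine ⟨fun U V W R hU hV hW hR => ?_,
    single 1 2 1, single 2 2 1, single 1 0 1, single 1 1 1,
    supportedOn_single (by decide),
    supportedOn_single (by decide),
    supportedOn_single (by decide),
    supportedOn_single (by decide), ?_⟩
  · simp only [Finset.forall_mem_insert, Finset.mem_singleton, forall_eq] at hU hV hW hR
    rw [det_fin_two]
    simp [lhs_eq, hU, hV, hW, hR]
    ring
  · rw [det_fin_two]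
    simp [rhs_eq]

theorem minorObstruction_123_124 :
    MinorObstruction ![0, 1, 2] ![0, 1, 3] {(0, 0), (0, 1), (1, 0), (2, 1)}
      ∅ := by
  refine ⟨fun U V W R hU hV hW hR => ?_,
    single 0 0 1 + single 2 1 1, single 0 1 1 + single 1 0 1, single 0 1 1, single 0 0 1,
    (supportedOn_single (by decide)).add (supportedOn_single (by decide)),
    (supportedOn_single (by decide)).add (supportedOn_single (by decide)),
    supportedOn_single (by decide),
    supportedOn_single (by decide), ?_⟩
  · rw [det_fin_three]
    simp [lhs_eq]
    ring
  · rw [det_fin_three]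
    simp [rhs_eq]

theorem minorObstruction_123_456 :
    MinorObstruction ![0, 1, 2] ![3, 4, 5] {(0, 1), (0, 2), (2, 1)}
      {(0, 0), (1, 0), (2, 0)} := by
  refine ⟨fun U V W R hU hV hW hR => ?_,
    0, single 0 2 1 + single 2 1 1, single 0 2 1, single 0 1 1,
    supportedOn_zero _,
    (supportedOn_single (by decide)).add (supportedOn_single (by decide)),
    supportedOn_single (by decide),
    supportedOn_single (by decide), ?_⟩
  · simp only [Finset.forall_mem_insert, Finset.mem_singleton, forall_eq] at hU hV hW hR
    rw [det_fin_three]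
    simp [lhs_eq, hU, hV, hW, hR]
    ring
  · rw [det_fin_three]
    simp [rhs_eq]

theorem minorObstruction_124_356 :
    MinorObstruction ![0, 1, 3] ![2, 4, 5] {(0, 0), (0, 2), (1, 2)}
      {(2, 0), (2, 1), (2, 2)} := by
  refine ⟨fun U V W R hU hV hW hR => ?_,
    single 1 2 1, single 0 2 1, single 0 0 1 + single 1 2 1, 0,
    supportedOn_single (by decide),
    supportedOn_single (by decide),
    (supportedOn_single (by decide)).add (supportedOn_single (by decide)),
    supportedOn_zero _, ?_⟩
  · simp only [Finset.forall_mem_insert, Finset.mem_singleton, forall_eq] at hU hV hW hR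
    rw [det_fin_three]
    simp [lhs_eq, hU, hV, hW, hR]
    ring
  · rw [det_fin_three]
    simp [rhs_eq]

theorem minorObstruction_135_356 :
    MinorObstruction ![0, 2, 4] ![2, 4, 5] {(0, 0), (0, 2), (1, 1), (2, 2)}
      {(0, 1), (2, 1)} := by
  refine ⟨fun U V W R hU hV hW hR => ?_,
    single 0 2 1, single 0 0 1 + single 2 2 1, single 2 2 1, single 0 2 1 + single 1 1 1,
    supportedOn_single (by decide),
    (supportedOn_single (by decide)).add (supportedOn_single (by decide)),
    supportedOn_single (by decide),
    (supportedOn_single (by decide)).add (supportedOn_single (by decide)), ?_⟩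
  · simp only [Finset.forall_mem_insert, Finset.mem_singleton, forall_eq] at hU hV hW hR
    rw [det_fin_three]
    simp [lhs_eq, hU, hV, hW, hR]
    ring
  · rw [det_fin_three]
    simp [rhs_eq]

/-! ### The local Yang–Baxter equation for `2 × 2` matrices -/

/-- The rows and columns `1, 2, 4` of the tetrahedron equation, for matrices whose upper left
`2 × 2` block `G` is their only part that matters there. This is the local Yang–Baxter equation
`G₁₂(u) G₁₄(v) G₂₄(w) = G₂₄(Z) G₁₄(Y) G₁₂(X)`; the field `hij` compares the entries `(i, j)`. -/
structure LocalYangBaxter (u v w : Fin 2 → Fin 2 → ℂ) (X Y Z : Matrix (Fin 3) (Fin 3) ℂ) :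
    Prop where
  h11 : u 0 0 * v 0 0 = Y 0 0 * X 0 0
  h12 : u 0 0 * v 0 1 * w 1 0 + u 0 1 * w 0 0 = Y 0 0 * X 0 1
  h14 : u 0 0 * v 0 1 * w 1 1 + u 0 1 * w 0 1 = Y 0 1
  h21 : u 1 0 * v 0 0 = Z 0 0 * X 1 0 + Z 0 1 * Y 1 0 * X 0 0
  h22 : u 1 0 * v 0 1 * w 1 0 + u 1 1 * w 0 0 = Z 0 0 * X 1 1 + Z 0 1 * Y 1 0 * X 0 1
  h24 : u 1 0 * v 0 1 * w 1 1 + u 1 1 * w 0 1 = Z 0 1 * Y 1 1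
  h41 : v 1 0 = Z 1 0 * X 1 0 + Z 1 1 * Y 1 0 * X 0 0
  h42 : v 1 1 * w 1 0 = Z 1 0 * X 1 1 + Z 1 1 * Y 1 0 * X 0 1
  h44 : v 1 1 * w 1 1 = Z 1 1 * Y 1 1

/-- The `2 × 2` matrix `u`, placed in the upper left corner, vanishes outside the slots in `S`. -/
def CornerSupportedOn (S : Finset Slot) (u : Fin 2 → Fin 2 → ℂ) : Prop :=
  ∀ i j : Fin 2, (i.castSucc, j.castSucc) ∉ S → u i j = 0

theorem cornerSupportedOn_iff {S : Finset Slot} {a b c d : ℂ} :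
    CornerSupportedOn S ![![a, b], ![c, d]] ↔
      ((0, 0) ∉ S → a = 0) ∧ ((0, 1) ∉ S → b = 0) ∧ ((1, 0) ∉ S → c = 0) ∧
        ((1, 1) ∉ S → d = 0) := by
  simp [CornerSupportedOn, Fin.forall_fin_two, and_assoc]

/-- A quadruple of matrices supported on `S`, at which none of the polynomials that have to be
avoided below vanishes: all the entries in `S` are `1`, except that the first matrix has the upper
left entry `2`. (If all of them were `1`, the polynomial for a full `2 × 2` block would vanish.) -/
def testPoint (S : Finset Slot) : Fin 4 → Matrix (Fin 3) (Fin 3) ℂ :=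
  fun q => Matrix.of fun i j =>
    if (i, j) ∈ S then if q = 0 ∧ i = 0 ∧ j = 0 then 2 else 1 else 0

theorem testPoint_supportedOn (S : Finset Slot) (q : Fin 4) : SupportedOn S (testPoint S q) := by
  intro i j h
  simp [testPoint, h]

/-- For generic matrices `X, Y, Z` supported on `S`, the local Yang–Baxter equation has a solution
in `2 × 2` matrices supported on `S`. -/
def YangBaxterSolvableOn (S : Finset Slot) : Prop :=
  ∃ f, IsPolynomialFun f ∧ f (testPoint S) ≠ 0 ∧
    ∀ M, (∀ q, SupportedOn S (M q)) → f M ≠ 0 →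
      ∃ u v w, CornerSupportedOn S u ∧ CornerSupportedOn S v ∧ CornerSupportedOn S w ∧
        LocalYangBaxter u v w (M 0) (M 1) (M 2)

/-- A number that acts as `1` on the entries in a given slot, and is `0` if the slot is empty. -/
theorem exists_slot_unit (S : Finset Slot) (i j : Fin 3) :
    ∃ e : ℂ, ((i, j) ∉ S → e = 0) ∧ ∀ M, SupportedOn S M → e * M i j = M i j := by
  by_cases h : (i, j) ∈ S
  · exact ⟨1, fun h' => absurd h h', fun M _ => one_mul _⟩
  · exact ⟨0, fun _ => rfl, fun M hM => by rw [hM i j h, zero_mul]⟩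

theorem YangBaxterSolvableOn.of_forall {S : Finset Slot}
    (h : ∀ M : Fin 4 → Matrix (Fin 3) (Fin 3) ℂ, (∀ q, SupportedOn S (M q)) →
      ∃ u v w, CornerSupportedOn S u ∧ CornerSupportedOn S v ∧ CornerSupportedOn S w ∧
        LocalYangBaxter u v w (M 0) (M 1) (M 2)) : YangBaxterSolvableOn S :=
  ⟨fun _ => 1, IsPolynomialFun.const 1, one_ne_zero, fun M hM _ => h M hM⟩

theorem yangBaxter_diagonal {S : Finset Slot} (hb : (0, 1) ∉ S) (hc : (1, 0) ∉ S) :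
    YangBaxterSolvableOn S := by
  refine .of_forall fun M hM => ?_
  have h00 := fun h q => hM q 0 0 h
  have h11 := fun h q => hM q 1 1 h
  have h01 := fun q => hM q 0 1 hb
  have h10 := fun q => hM q 1 0 hc
  refine ⟨![![M 0 0 0, 0], ![0, M 0 1 1]], ![![M 1 0 0, 0], ![0, M 1 1 1]],
    ![![M 2 0 0, 0], ![0, M 2 1 1]], ?_, ?_, ?_, ?_⟩
  iterate 3 rw [cornerSupportedOn_iff]; simp +contextual [h00, h11]
  constructor <;> simp [h01, h10] <;> ring

/-- The entries `(1, 2)`, `(2, 2)`, `(2, 4)` determine `u₀₁`, `u₁₁`, `w₀₁` after the normalization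
`w₀₀ = 1`, and then the entry `(1, 4)` determines `v₀₁`. -/
theorem yangBaxter_upper_triangular {S : Finset Slot} (ha : (0, 0) ∈ S) (hb : (0, 1) ∈ S)
    (hc : (1, 0) ∉ S) (hd : (1, 1) ∈ S) : YangBaxterSolvableOn S := by
  refine ⟨fun M => M 0 0 0 * M 1 0 0 * M 2 0 0 * M 0 1 1, ?_, ?_, fun M hM hf => ?_⟩
  · repeat' first | exact .entry _ _ _ | apply IsPolynomialFun.mul
  · simp [testPoint, ha, hd]
  have h10 := fun q => hM q 1 0 hc
  obtain ⟨⟨⟨hx, hy⟩, hz⟩, hx'⟩ : ((M 0 0 0 ≠ 0 ∧ M 1 0 0 ≠ 0) ∧ M 2 0 0 ≠ 0) ∧ M 0 1 1 ≠ 0 := by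
    simpa [mul_ne_zero_iff] using hf
  refine ⟨![![M 0 0 0 * M 1 0 0, M 0 0 1 * M 1 0 0], ![0, M 2 0 0 * M 0 1 1]],
    ![![1, (M 1 0 1 - M 0 0 1 * M 1 0 0 * (M 2 0 1 * M 1 1 1 / (M 2 0 0 * M 0 1 1))) /
      (M 0 0 0 * M 1 0 0)], ![0, M 2 1 1 * M 1 1 1]],
    ![![1, M 2 0 1 * M 1 1 1 / (M 2 0 0 * M 0 1 1)], ![0, 1]], ?_, ?_, ?_, ?_⟩
  iterate 3 rw [cornerSupportedOn_iff]; simp [ha, hb, hd]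
  constructor <;> simp [h10] <;> field_simp; ring

theorem yangBaxter_zero_left_column {S : Finset Slot} (ha : (0, 0) ∉ S) (hb : (0, 1) ∈ S)
    (hc : (1, 0) ∉ S) : YangBaxterSolvableOn S := by
  refine .of_forall fun M hM => ?_
  have h00 := fun q => hM q 0 0 ha
  have h10 := fun q => hM q 1 0 hc
  have h11 := fun h q => hM q 1 1 h
  refine ⟨![![0, M 1 0 1], ![0, M 2 0 1 * M 1 1 1]], ![![0, 0], ![0, M 1 1 1]],
    ![![0, 1], ![0, M 2 1 1]], ?_, ?_, ?_, ?_⟩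
  iterate 3 rw [cornerSupportedOn_iff]; simp +contextual [hb, h11]
  constructor <;> simp [h00, h10]; ring

theorem yangBaxter_zero_lower_row {S : Finset Slot} (hb : (0, 1) ∈ S) (hc : (1, 0) ∉ S)
    (hd : (1, 1) ∉ S) : YangBaxterSolvableOn S := by
  refine .of_forall fun M hM => ?_
  have h00 := fun h q => hM q 0 0 h
  have h10 := fun q => hM q 1 0 hc
  have h11 := fun q => hM q 1 1 hd
  refine ⟨![![M 0 0 0, 1], ![0, 0]], ![![M 1 0 0, 0], ![0, 0]],
    ![![M 1 0 0 * M 0 0 1, M 1 0 1], ![0, 0]], ?_, ?_, ?_, ?_⟩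
  iterate 3 rw [cornerSupportedOn_iff]; simp +contextual [hb, h00]
  constructor <;> simp [h10, h11]; ring

theorem yangBaxter_lower_triangular {S : Finset Slot} (hb : (0, 1) ∉ S) (hc : (1, 0) ∈ S) :
    YangBaxterSolvableOn S := by
  refine .of_forall fun M hM => ?_
  have h00 := fun h q => hM q 0 0 h
  have h01 := fun q => hM q 0 1 hb
  have h11 := fun h q => hM q 1 1 h
  obtain ⟨a, ha, ha'⟩ := exists_slot_unit S 0 0
  obtain ⟨d, hd, hd'⟩ := exists_slot_unit S 1 1
  replace ha' := fun q => ha' _ (hM q)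
  replace hd' := fun q => hd' _ (hM q)
  refine ⟨![![M 0 0 0 * M 1 0 0, 0], ![M 2 0 0 * M 0 1 0, M 0 1 1]],
    ![![a, 0], ![M 2 1 0 * M 0 1 0 + M 2 1 1 * M 1 1 0 * M 0 0 0, d]],
    ![![M 2 0 0, 0], ![M 2 1 0 * M 0 1 1, M 2 1 1 * M 1 1 1]], ?_, ?_, ?_, ?_⟩
  iterate 3 rw [cornerSupportedOn_iff]; simp +contextual [hc, h00, h11, ha, hd]
  constructor <;> simp [h01]
  · linear_combination M 0 0 0 * ha' 1
  · linear_combination M 0 1 0 * ha' 2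
  · ring
  · linear_combination M 2 1 0 * hd' 0
  · linear_combination M 1 1 1 * hd' 2

theorem yangBaxter_antidiagonal {S : Finset Slot} (ha : (0, 0) ∉ S) (hb : (0, 1) ∈ S)
    (hc : (1, 0) ∈ S) (hd : (1, 1) ∉ S) : YangBaxterSolvableOn S := by
  refine .of_forall fun M hM => ?_
  have h00 := fun q => hM q 0 0 ha
  have h11 := fun q => hM q 1 1 hd
  refine ⟨![![0, 1], ![1, 0]], ![![0, 1], ![M 2 1 0 * M 0 1 0, 0]],
    ![![0, M 1 0 1], ![M 2 0 1 * M 1 1 0 * M 0 0 1, 0]], ?_, ?_, ?_, ?_⟩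
  iterate 3 rw [cornerSupportedOn_iff]; simp [hb, hc]
  constructor <;> simp [h00, h11]

theorem yangBaxter_zero_lower_right {S : Finset Slot} (ha : (0, 0) ∈ S) (hb : (0, 1) ∈ S)
    (hc : (1, 0) ∈ S) (hd : (1, 1) ∉ S) : YangBaxterSolvableOn S := by
  refine ⟨fun M => M 2 0 0 * M 0 1 0 + M 2 0 1 * M 1 1 0 * M 0 0 0, ?_, ?_, fun M hM hf => ?_⟩
  · repeat' first | exact .entry _ _ _ | apply IsPolynomialFun.mul | apply IsPolynomialFun.add
  · norm_num [testPoint, show (2 : Fin 4) ≠ 0 by decide, ha, hb, hc]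
  have h11 := fun q => hM q 1 1 hd
  obtain ⟨K, hK⟩ : ∃ K, K = M 2 0 0 * M 0 1 0 + M 2 0 1 * M 1 1 0 * M 0 0 0 := ⟨_, rfl⟩
  have hK0 : K ≠ 0 := hK ▸ hf
  refine ⟨![![M 0 0 0 * M 1 0 0, 1], ![K, 0]],
    ![![1, M 2 0 1 * M 1 1 0 * M 0 0 1 / K], ![M 2 1 0 * M 0 1 0, 0]],
    ![![M 0 0 1 * M 1 0 0 - M 0 0 0 * M 1 0 0 * (M 2 0 1 * M 1 1 0 * M 0 0 1 / K), M 1 0 1],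
      ![1, 0]], ?_, ?_, ?_, ?_⟩
  iterate 3 rw [cornerSupportedOn_iff]; simp [ha, hb, hc]
  constructor <;> simp [h11, ← hK] <;> field_simp

theorem yangBaxter_zero_upper_left {S : Finset Slot} (ha : (0, 0) ∉ S) (hb : (0, 1) ∈ S)
    (hc : (1, 0) ∈ S) (hd : (1, 1) ∈ S) : YangBaxterSolvableOn S := by
  refine ⟨fun M => M 2 1 0 * M 0 1 1 + M 2 1 1 * M 1 1 0 * M 0 0 1, ?_, ?_, fun M hM hf => ?_⟩
  · repeat' first | exact .entry _ _ _ | apply IsPolynomialFun.mul | apply IsPolynomialFun.add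
  · norm_num [testPoint, show (2 : Fin 4) ≠ 0 by decide, hb, hc, hd]
  have h00 := fun q => hM q 0 0 ha
  obtain ⟨K, hK⟩ : ∃ K, K = M 2 1 0 * M 0 1 1 + M 2 1 1 * M 1 1 0 * M 0 0 1 := ⟨_, rfl⟩
  have hK0 : K ≠ 0 := hK ▸ hf
  refine ⟨![![0, M 1 0 1], ![1, M 2 0 1 * M 1 1 1 - M 2 0 1 * M 1 1 0 * M 0 0 1 / K *
      (M 2 1 1 * M 1 1 1)]],
    ![![0, M 2 0 1 * M 1 1 0 * M 0 0 1 / K], ![M 2 1 0 * M 0 1 0, 1]],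
    ![![0, 1], ![K, M 2 1 1 * M 1 1 1]], ?_, ?_, ?_, ?_⟩
  iterate 3 rw [cornerSupportedOn_iff]; simp [hb, hc, hd]
  constructor <;> simp [h00, ← hK]; field_simp

/-- A generic `3 × 3` matrix `(mᵢⱼ)` has a factorization `G₁₂(u) G₁₃(v) G₂₃(w)` with `2 × 2` matrices
`u, v, w` such that `v₁₁ = v₂₂ = w₁₁ = 1`. The number `v₁₂` is determined by the requirement that
the matrix `(m₁₂, m₁₃; m₂₂, m₂₃)`, diminished by `v₁₂ (m₁₁, m₂₁)ᵀ (m₃₂, m₃₃)`, has rank one. -/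
theorem exists_factorization {m11 m12 m13 m21 m22 m23 m32 m33 D : ℂ}
    (hD : D = m32 * (m23 * m11 - m13 * m21) + m33 * (m12 * m21 - m22 * m11)) (hD0 : D ≠ 0)
    (h : m12 * D - (m12 * m23 - m13 * m22) * m11 * m32 ≠ 0) :
    ∃ u01 u11 v w : ℂ, m11 * v * m32 + u01 = m12 ∧ m11 * v * m33 + u01 * w = m13 ∧
      m21 * v * m32 + u11 = m22 ∧ m21 * v * m33 + u11 * w = m23 := by
  refine ⟨m12 - m11 * ((m12 * m23 - m13 * m22) / D) * m32,
    m22 - m21 * ((m12 * m23 - m13 * m22) / D) * m32, (m12 * m23 - m13 * m22) / D,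
    (m13 - m11 * ((m12 * m23 - m13 * m22) / D) * m33) /
      (m12 - m11 * ((m12 * m23 - m13 * m22) / D) * m32), by ring, ?_, by ring, ?_⟩
  all_goals
    generalize hv : (m12 * m23 - m13 * m22) / D = v
    have hv' : m12 * m23 - m13 * m22 = v * D := by rw [← hv]; field_simp
    have h0 : m12 - m11 * v * m32 ≠ 0 := by
      intro h0
      apply h
      rw [hv']
      linear_combination D * h0
    rw [← mul_div_assoc, ← eq_sub_iff_add_eq', div_eq_iff h0]
  · ring
  · subst hD
    linear_combination -hv'

theorem yangBaxter_full {S : Finset Slot} (ha : (0, 0) ∈ S) (hb : (0, 1) ∈ S)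
    (hc : (1, 0) ∈ S) (hd : (1, 1) ∈ S) : YangBaxterSolvableOn S := by
  let m11 := fun M : Fin 4 → Matrix (Fin 3) (Fin 3) ℂ => M 1 0 0 * M 0 0 0
  let m12 := fun M : Fin 4 → Matrix (Fin 3) (Fin 3) ℂ => M 1 0 0 * M 0 0 1
  let m13 := fun M : Fin 4 → Matrix (Fin 3) (Fin 3) ℂ => M 1 0 1
  let m21 := fun M : Fin 4 → Matrix (Fin 3) (Fin 3) ℂ =>
    M 2 0 0 * M 0 1 0 + M 2 0 1 * M 1 1 0 * M 0 0 0
  let m22 := fun M : Fin 4 → Matrix (Fin 3) (Fin 3) ℂ =>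
    M 2 0 0 * M 0 1 1 + M 2 0 1 * M 1 1 0 * M 0 0 1
  let m23 := fun M : Fin 4 → Matrix (Fin 3) (Fin 3) ℂ => M 2 0 1 * M 1 1 1
  let m32 := fun M : Fin 4 → Matrix (Fin 3) (Fin 3) ℂ =>
    M 2 1 0 * M 0 1 1 + M 2 1 1 * M 1 1 0 * M 0 0 1
  let m33 := fun M : Fin 4 → Matrix (Fin 3) (Fin 3) ℂ => M 2 1 1 * M 1 1 1
  let D := fun M => m32 M * (m23 M * m11 M - m13 M * m21 M) +
    m33 M * (m12 M * m21 M - m22 M * m11 M)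
  refine ⟨fun M => D M * (m12 M * D M - (m12 M * m23 M - m13 M * m22 M) * m11 M * m32 M), ?_, ?_,
    fun M hM hf => ?_⟩
  · simp only [D, m11, m12, m13, m21, m22, m23, m32, m33]
    repeat' first | exact .entry _ _ _ | apply IsPolynomialFun.mul | apply IsPolynomialFun.add |
      apply IsPolynomialFun.sub
  · norm_num [testPoint, show (2 : Fin 4) ≠ 0 by decide, ha, hb, hc, hd, D,
      m11, m12, m13, m21, m22, m23, m32, m33]
  obtain ⟨u01, u11, v, w, h12, h13, h22, h23⟩ := exists_factorization (D := D M) rfl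
    (left_ne_zero_of_mul hf) (right_ne_zero_of_mul hf)
  refine ⟨![![m11 M, u01], ![m21 M, u11]],
    ![![1, v], ![M 2 1 0 * M 0 1 0 + M 2 1 1 * M 1 1 0 * M 0 0 0, 1]],
    ![![1, w], ![m32 M, m33 M]], ?_, ?_, ?_, ?_⟩
  iterate 3 rw [cornerSupportedOn_iff]; simp [ha, hb, hc, hd]
  constructor <;> simp [h12, h13, h22, h23] <;> simp [m11, m12, m13, m21, m22, m23, m32, m33]

theorem yangBaxterSolvableOn (S : Finset Slot) : YangBaxterSolvableOn S := by
  by_cases hb : (0, 1) ∈ S <;> by_cases hc : (1, 0) ∈ S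
  · by_cases ha : (0, 0) ∈ S <;> by_cases hd : (1, 1) ∈ S
    · exact yangBaxter_full ha hb hc hd
    · exact yangBaxter_zero_lower_right ha hb hc hd
    · exact yangBaxter_zero_upper_left ha hb hc hd
    · exact yangBaxter_antidiagonal ha hb hc hd
  · by_cases ha : (0, 0) ∈ S
    · by_cases hd : (1, 1) ∈ S
      · exact yangBaxter_upper_triangular ha hb hc hd
      · exact yangBaxter_zero_lower_row hb hc hd
    · exact yangBaxter_zero_left_column ha hb hc
  · exact yangBaxter_lower_triangular hb hc
  · exact yangBaxter_diagonal hb hc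

/-! ### Solvable forms -/

/-- The `3 × 3` matrix with the `2 × 2` matrix `u` in its upper left corner, with lower right entry
`e`, and with the entry `b` above it. -/
def cornerMat (u : Fin 2 → Fin 2 → ℂ) (b e : ℂ) : Matrix (Fin 3) (Fin 3) ℂ :=
  !![u 0 0, u 0 1, 0; u 1 0, u 1 1, b; 0, 0, e]

theorem supportedOn_of_entries {S : Finset Slot} {a b c d e f g h i : ℂ}
    (h00 : (0, 0) ∉ S → a = 0) (h01 : (0, 1) ∉ S → b = 0) (h02 : (0, 2) ∉ S → c = 0)
    (h10 : (1, 0) ∉ S → d = 0) (h11 : (1, 1) ∉ S → e = 0) (h12 : (1, 2) ∉ S → f = 0)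
    (h20 : (2, 0) ∉ S → g = 0) (h21 : (2, 1) ∉ S → h = 0) (h22 : (2, 2) ∉ S → i = 0) :
    SupportedOn S !![a, b, c; d, e, f; g, h, i] := by
  intro i j
  fin_cases i <;> fin_cases j <;> assumption

theorem CornerSupportedOn.cornerMat {S : Finset Slot} {u : Fin 2 → Fin 2 → ℂ}
    (hu : CornerSupportedOn S u) {b e : ℂ} (hb : (1, 2) ∉ S → b = 0) (he : (2, 2) ∉ S → e = 0) :
    SupportedOn S (cornerMat u b e) :=
  supportedOn_of_entries (hu 0 0) (hu 0 1) (fun _ => rfl) (hu 1 0) (hu 1 1) hb (fun _ => rfl)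
    (fun _ => rfl) he

/-- For block diagonal forms the equation splits: in the rows and columns `1, 2, 4` it is the local
Yang–Baxter equation, in the rows and columns `3, 5` it is an equation between rescaled `2 × 2`
matrices, and in row and column `6` it is an equation between numbers. -/
theorem solvableOn_of_subset_formA {S : Finset Slot} (hS : S ⊆ formA.slots) : SolvableOn S := by
  obtain ⟨f, hf, hf0, h⟩ := yangBaxterSolvableOn S
  have h02 : (0, 2) ∉ S := fun h => absurd (hS h) (by decide)
  have h12 : (1, 2) ∉ S := fun h => absurd (hS h) (by decide)
  have h20 : (2, 0) ∉ S := fun h => absurd (hS h) (by decide)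
  have h21 : (2, 1) ∉ S := fun h => absurd (hS h) (by decide)
  by_cases h22 : (2, 2) ∈ S
  · refine ⟨fun M => f M * (M 0 2 2 * M 1 2 2), hf.mul (.mul (.entry _ _ _) (.entry _ _ _)),
      ⟨testPoint S, testPoint_supportedOn S, ?_⟩, fun M hM hfM => ?_⟩
    · simp [hf0, testPoint, h22]
    obtain ⟨u, v, w, hu, hv, hw, hyb⟩ := h M hM (left_ne_zero_of_mul hfM)
    have hx := left_ne_zero_of_mul (right_ne_zero_of_mul hfM)
    have hy := right_ne_zero_of_mul (right_ne_zero_of_mul hfM)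
    refine ⟨cornerMat u 0 (M 0 2 2), cornerMat v 0 (M 1 2 2), cornerMat w 0 (M 2 2 2),
      !![M 3 0 0, M 3 0 1 * M 1 2 2 / M 0 2 2, 0; M 3 1 0 * M 0 2 2 / M 1 2 2, M 3 1 1, 0;
        0, 0, M 3 2 2], hu.cornerMat (by simp) (by simp [h22]),
      hv.cornerMat (by simp) (by simp [h22]), hw.cornerMat (by simp) (by simp [h22]), ?_, ?_⟩
    · apply supportedOn_of_entries <;> intro h' <;> simp [hM 3 _ _ h']
    · obtain ⟨e11, e12, e14, e21, e22, e24, e41, e42, e44⟩ := hyb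
      have z02 := fun q => hM q _ _ h02
      have z12 := fun q => hM q _ _ h12
      have z20 := fun q => hM q _ _ h20
      have z21 := fun q => hM q _ _ h21
      rw [lhs_eq, rhs_eq]
      simp only [EmbeddingLike.apply_eq_iff_eq, vecCons_inj]
      simp [cornerMat, z02, z12, z20, z21, e11, e12, e14, e21, e22, e24, e41, e42, e44]
      and_intros <;> field_simp
  · refine ⟨f, hf, ⟨testPoint S, testPoint_supportedOn S, hf0⟩, fun M hM hfM => ?_⟩
    obtain ⟨u, v, w, hu, hv, hw, hyb⟩ := h M hM hfM
    refine ⟨cornerMat u 0 0, cornerMat v 0 0, cornerMat w 0 0, 0, hu.cornerMat (by simp) (by simp),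
      hv.cornerMat (by simp) (by simp), hw.cornerMat (by simp) (by simp), supportedOn_zero S, ?_⟩
    obtain ⟨e11, e12, e14, e21, e22, e24, e41, e42, e44⟩ := hyb
    have z02 := fun q => hM q _ _ h02
    have z12 := fun q => hM q _ _ h12
    have z20 := fun q => hM q _ _ h20
    have z21 := fun q => hM q _ _ h21
    have z22 := fun q => hM q _ _ h22
    rw [lhs_eq, rhs_eq]
    simp only [EmbeddingLike.apply_eq_iff_eq, vecCons_inj]
    simp [cornerMat, z02, z12, z20, z21, z22, e11, e12, e14, e21, e22, e24, e41, e42, e44]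

/-- If the slot `(1, 2)` is occupied, the rows and columns `1, 2, 4` contain the local Yang–Baxter
equation, and the matrix `R` can be read off from the other entries. -/
theorem solvableOn_of_subset_formB {S : Finset Slot} (hS : S ⊆ formB.slots) : SolvableOn S := by
  by_cases h12 : (1, 2) ∈ S
  · obtain ⟨f, hf, hf0, h⟩ := yangBaxterSolvableOn S
    have h02 : (0, 2) ∉ S := fun h => absurd (hS h) (by decide)
    have h20 : (2, 0) ∉ S := fun h => absurd (hS h) (by decide)
    have h21 : (2, 1) ∉ S := fun h => absurd (hS h) (by decide)
    have h22 : (2, 2) ∉ S := fun h => absurd (hS h) (by decide)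
    refine ⟨f, hf, ⟨testPoint S, testPoint_supportedOn S, hf0⟩, fun M hM hfM => ?_⟩
    obtain ⟨u, v, w, hu, hv, hw, hyb⟩ := h M hM hfM
    refine ⟨cornerMat u 1 0, cornerMat v 1 0, cornerMat w 0 0,
      !![M 2 0 0 * M 0 1 2, M 2 0 1 * M 1 1 2, 0; M 2 1 0 * M 0 1 2, M 2 1 1 * M 1 1 2, M 2 1 2;
        0, 0, 0], hu.cornerMat (by simp [h12]) (by simp),
      hv.cornerMat (by simp [h12]) (by simp), hw.cornerMat (by simp) (by simp), ?_, ?_⟩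
    · apply supportedOn_of_entries <;> intro h' <;> simp [hM 2 _ _ h']
    · obtain ⟨e11, e12, e14, e21, e22, e24, e41, e42, e44⟩ := hyb
      have z02 := fun q => hM q _ _ h02
      have z20 := fun q => hM q _ _ h20
      have z21 := fun q => hM q _ _ h21
      have z22 := fun q => hM q _ _ h22
      rw [lhs_eq, rhs_eq]
      simp only [EmbeddingLike.apply_eq_iff_eq, vecCons_inj]
      simp [cornerMat, z02, z20, z21, z22, e11, e12, e14, e21, e22, e24, e41, e42, e44]
  · refine solvableOn_of_subset_formA fun s hs => ?_
    have h : s ≠ (1, 2) := fun h => h12 (h ▸ hs)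
    have : ∀ s ∈ formB.slots, s ≠ (1, 2) → s ∈ formA.slots := by decide
    exact this s (hS hs) h

/-- For the form `C` the entries of the equation are `w₁₀ v₂₁ = K`, with a polynomial `K` in the
given variables, `u₁₀ v₀₁ w₁₀ = m`, with a monomial `m`, and equations that are easily solved. If
both the slots `(1, 0)` and `(2, 1)` are occupied, this needs `K ≠ 0`; otherwise `K` vanishes and
`w₁₀` can be chosen freely. -/
theorem solvableOn_of_subset_formC {S : Finset Slot} (hS : S ⊆ formC.slots) : SolvableOn S := by
  have h00 : (0, 0) ∉ S := fun h => absurd (hS h) (by decide)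
  have h02 : (0, 2) ∉ S := fun h => absurd (hS h) (by decide)
  have h11 : (1, 1) ∉ S := fun h => absurd (hS h) (by decide)
  have h20 : (2, 0) ∉ S := fun h => absurd (hS h) (by decide)
  have h22 : (2, 2) ∉ S := fun h => absurd (hS h) (by decide)
  obtain ⟨e01, he01, he01'⟩ := exists_slot_unit S 0 1
  obtain ⟨e12, he12, he12'⟩ := exists_slot_unit S 1 2
  by_cases h : (1, 0) ∈ S ∧ (2, 1) ∈ S
  · obtain ⟨h10, h21⟩ := h
    refine ⟨fun M => M 3 1 0 * M 0 2 1 + M 3 1 2 * M 2 2 1 * M 1 1 0 * M 0 0 1, ?_,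
      ⟨testPoint S, testPoint_supportedOn S, ?_⟩, fun M hM hfM => ?_⟩
    · repeat' first | exact .entry _ _ _ | apply IsPolynomialFun.mul | apply IsPolynomialFun.add
    · simp only [testPoint, Matrix.of_apply, h10, h21]
      split_ifs <;> simp_all
    have z00 := fun q => hM q _ _ h00
    have z02 := fun q => hM q _ _ h02
    have z11 := fun q => hM q _ _ h11
    have z20 := fun q => hM q _ _ h20
    have z22 := fun q => hM q _ _ h22
    replace he01' := fun q => he01' _ (hM q)
    replace he12' := fun q => he12' _ (hM q)
    obtain ⟨K, hK⟩ : ∃ K, K = M 3 1 0 * M 0 2 1 + M 3 1 2 * M 2 2 1 * M 1 1 0 * M 0 0 1 :=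
      ⟨_, rfl⟩
    have hK0 : K ≠ 0 := hK ▸ hfM
    refine ⟨!![0, M 1 0 1, 0;
        1, 0, M 1 1 2 * (1 - M 1 1 0 * M 0 0 1 * M 3 1 2 * M 2 2 1 / K); 0, M 3 0 1 * M 1 2 1, 0],
      !![0, M 2 0 1 * M 1 1 0 * M 0 0 1 / K, 0; M 2 1 0 * M 0 1 0, 0, e12; 0, 1, 0],
      !![0, e01, 0; K, 0, M 3 1 2 * M 1 1 2; 0, M 3 2 1 * M 1 2 1, 0],
      !![0, M 2 0 1, 0; M 2 1 0 * M 0 1 2, 0, M 2 1 2; 0, M 2 2 1, 0], ?_, ?_, ?_, ?_, ?_⟩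
    iterate 4
      apply supportedOn_of_entries <;> intro h' <;>
        first | contradiction | simp [hM _ _ _ h'] | simp [he01 h'] | simp [he12 h']
    rw [lhs_eq, rhs_eq]
    simp only [EmbeddingLike.apply_eq_iff_eq, vecCons_inj]
    simp only [Matrix.of_apply, cons_val, z00, z02, z11, z20, z22, zero_mul, mul_zero, add_zero,
      zero_add, one_mul, and_true, true_and]
    refine ⟨?_, ⟨?_, ?_⟩, ?_, ⟨?_, ?_⟩, hK, ?_⟩
    · linear_combination he01' 1
    · field_simp
    · field_simp
      ring
    · linear_combination M 1 2 1 * he01' 3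
    · linear_combination M 2 1 0 * he12' 0
    · exact he12' 2
    · ring
  · obtain ⟨e10, he10, he10'⟩ := exists_slot_unit S 1 0
    obtain ⟨e21, he21, he21'⟩ := exists_slot_unit S 2 1
    refine ⟨fun _ => 1, .const 1, ⟨testPoint S, testPoint_supportedOn S, one_ne_zero⟩,
      fun M hM _ => ?_⟩
    have z00 := fun q => hM q _ _ h00
    have z02 := fun q => hM q _ _ h02
    have z11 := fun q => hM q _ _ h11
    have z20 := fun q => hM q _ _ h20
    have z22 := fun q => hM q _ _ h22
    replace he01' := fun q => he01' _ (hM q)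
    replace he12' := fun q => he12' _ (hM q)
    replace he10' := fun q => he10' _ (hM q)
    replace he21' := fun q => he21' _ (hM q)
    have he : e21 * e10 = 0 := by
      by_cases h' : (1, 0) ∈ S
      · rw [he21 fun h'' => h ⟨h', h''⟩, zero_mul]
      · rw [he10 h', mul_zero]
    have hz : ∀ p q, M p 1 0 * M q 2 1 = 0 := fun p q => by
      rw [← he10', ← he21']
      linear_combination M p 1 0 * M q 2 1 * he
    refine ⟨!![0, M 1 0 1, 0; e10, 0, M 1 1 2; 0, M 3 0 1 * M 1 2 1, 0],
      !![0, M 2 0 1 * M 1 1 0 * M 0 0 1, 0; M 2 1 0 * M 0 1 0, 0, e12; 0, e21, 0],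
      !![0, e01, 0; e10, 0, M 3 1 2 * M 1 1 2; 0, M 3 2 1 * M 1 2 1, 0],
      !![0, M 2 0 1, 0; M 2 1 0 * M 0 1 2, 0, M 2 1 2; 0, M 2 2 1, 0], ?_, ?_, ?_, ?_, ?_⟩
    iterate 4
      apply supportedOn_of_entries <;> intro h' <;>
        first | simp [hM _ _ _ h'] | simp [he01 h'] | simp [he12 h'] | simp [he10 h'] |
          simp [he21 h']
    rw [lhs_eq, rhs_eq]
    simp only [EmbeddingLike.apply_eq_iff_eq, vecCons_inj]
    simp only [Matrix.of_apply, cons_val, z00, z02, z11, z20, z22, zero_mul, mul_zero, add_zero,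
      zero_add, and_true, true_and]
    refine ⟨?_, ⟨?_, ?_⟩, ?_, ⟨?_, ?_⟩, ⟨?_, ?_⟩⟩
    · linear_combination he01' 1
    · linear_combination M 2 0 1 * M 0 0 1 * (1 + e10) * he10' 1
    · linear_combination e10 * M 2 0 1 * M 0 0 1 * M 3 1 2 * M 1 1 2 * hz 1 2
    · linear_combination M 1 2 1 * he01' 3
    · linear_combination M 2 1 0 * he12' 0
    · exact he12' 2
    · linear_combination he - hz 3 0 - M 3 1 2 * M 0 0 1 * hz 1 2
    · linear_combination M 3 1 2 * M 1 1 2 * he21' 2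

theorem solvableOn_of_subset_formD {S : Finset Slot} (hS : S ⊆ formD.slots) : SolvableOn S := by
  have h00 : (0, 0) ∉ S := fun h => absurd (hS h) (by decide)
  have h01 : (0, 1) ∉ S := fun h => absurd (hS h) (by decide)
  have h02 : (0, 2) ∉ S := fun h => absurd (hS h) (by decide)
  have h11 : (1, 1) ∉ S := fun h => absurd (hS h) (by decide)
  have h12 : (1, 2) ∉ S := fun h => absurd (hS h) (by decide)
  have h20 : (2, 0) ∉ S := fun h => absurd (hS h) (by decide)
  obtain ⟨e, he, he'⟩ := exists_slot_unit S 2 2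
  refine ⟨fun _ => 1, .const 1, ⟨testPoint S, testPoint_supportedOn S, one_ne_zero⟩,
    fun M hM _ => ?_⟩
  have z00 := fun q => hM q _ _ h00
  have z01 := fun q => hM q _ _ h01
  have z02 := fun q => hM q _ _ h02
  have z11 := fun q => hM q _ _ h11
  have z12 := fun q => hM q _ _ h12
  have z20 := fun q => hM q _ _ h20
  replace he' := fun q => he' _ (hM q)
  refine ⟨0, !![0, 0, 0; M 2 1 0 * M 0 1 0, 0, 0; 0, M 0 2 1, M 0 2 2],
    !![0, 0, 0; M 3 1 0, 0, 0; 0, M 3 2 1 * M 1 2 1, e],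
    !![0, 0, 0; M 3 1 0, 0, 0; 0, M 3 2 1 * M 1 2 2, M 3 2 2 * M 2 2 2], supportedOn_zero S,
    ?_, ?_, ?_, ?_⟩
  iterate 3
    apply supportedOn_of_entries <;> intro h' <;>
      first | simp [hM _ _ _ h'] | simp [he h']
  rw [lhs_eq, rhs_eq]
  simp only [EmbeddingLike.apply_eq_iff_eq, vecCons_inj]
  simp [z00, z01, z02, z11, z12, z20]
  refine ⟨⟨mul_comm _ _, mul_comm _ _⟩, ?_, ?_⟩
  · linear_combination M 3 2 1 * he' 1
  · linear_combination M 3 2 2 * he' 2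

/-! ### The classification -/

/-- The pairs of a set of occupied slots and a set of empty slots for which some minor is an
obstruction. Among the forms generated by none of `A, B, C, D`, each one or its reflection shows one
of these patterns. -/
def obstructionPatterns : List (Finset Slot × Finset Slot) :=
  [({(0, 2)}, {(0, 0), (0, 1)}),
    ({(0, 2)}, {(0, 1), (1, 1)}),
    ({(0, 2), (1, 1), (2, 1)}, {(0, 1)}),
    ({(0, 2), (1, 0), (1, 2), (2, 1)}, {(2, 0), (2, 2)}),
    ({(2, 0)}, ∅),
    ({(0, 0), (1, 0), (2, 1), (2, 2)}, ∅),
    ({(0, 1), (1, 0), (2, 1), (2, 2)}, {(2, 0)}),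
    ({(0, 2)}, {(0, 0), (1, 0), (2, 1), (2, 2)}),
    ({(0, 0), (0, 1), (2, 1)}, {(1, 0), (1, 1)}),
    ({(0, 0), (0, 1), (1, 2), (2, 2)}, {(1, 0), (2, 0), (2, 1)}),
    ({(1, 0), (1, 1), (2, 1)}, ∅),
    ({(1, 0), (1, 1), (1, 2), (2, 2)}, {(2, 0), (2, 1)}),
    ({(0, 0), (0, 1), (1, 0), (2, 1)}, ∅),
    ({(0, 1), (0, 2), (2, 1)}, {(0, 0), (1, 0), (2, 0)}),
    ({(0, 0), (0, 2), (1, 2)}, {(2, 0), (2, 1), (2, 2)}),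
    ({(0, 0), (0, 2), (1, 1), (2, 2)}, {(0, 1), (2, 1)})]

theorem unsolvableOn_of_mem_obstructionPatterns {p : Finset Slot × Finset Slot}
    (hp : p ∈ obstructionPatterns) {S : Finset Slot} (hR : p.1 ⊆ S) (hN : Disjoint p.2 S) :
    UnsolvableOn S := by
  simp only [obstructionPatterns, List.mem_cons, List.not_mem_nil, or_false] at hp
  rcases hp with rfl | rfl | rfl | rfl | rfl | rfl | rfl | rfl | rfl | rfl |
    rfl | rfl | rfl | rfl | rfl | rfl
  · exact minorObstruction_1_5.unsolvableOn hR hN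
  · exact minorObstruction_1_5'.unsolvableOn hR hN
  · exact minorObstruction_3_4.unsolvableOn hR hN
  · exact minorObstruction_5_3.unsolvableOn hR hN
  · exact minorObstruction_6_1.unsolvableOn hR hN
  · exact minorObstruction_6_1'.unsolvableOn hR hN
  · exact minorObstruction_6_2.unsolvableOn hR hN
  · exact minorObstruction_12_56.unsolvableOn hR hN
  · exact minorObstruction_13_24.unsolvableOn hR hN
  · exact minorObstruction_23_35.unsolvableOn hR hN
  · exact minorObstruction_45_24.unsolvableOn hR hN
  · exact minorObstruction_45_35.unsolvableOn hR hN
  · exact minorObstruction_123_124.unsolvableOn hR hN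
  · exact minorObstruction_123_456.unsolvableOn hR hN
  · exact minorObstruction_124_356.unsolvableOn hR hN
  · exact minorObstruction_135_356.unsolvableOn hR hN

/-- The finite check behind the classification: a set of slots is contained, possibly after
reflection, in the set of slots of one of the four forms, or else it or its reflection shows one of
the patterns that prevent solvability. -/
theorem subset_or_obstruction : ∀ S : Finset Slot,
    (∃ n, S ⊆ (fourForms n).2.slots ∨ S ⊆ reflectSlots (fourForms n).2.slots) ∨
      ∃ p ∈ obstructionPatterns, (p.1 ⊆ S ∧ Disjoint p.2 S) ∨
        (p.1 ⊆ reflectSlots S ∧ Disjoint p.2 (reflectSlots S)) := by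
  decide +kernel

theorem exists_generatedBy_or_unsolvable {k : ℕ} (F : Form k) :
    (∃ n, GeneratedBy (fourForms n).2 k F) ∨ Unsolvable F := by
  simp only [generatedBy_iff]
  refine (subset_or_obstruction F.slots).imp_right ?_
  rintro ⟨p, hp, ⟨hR, hN⟩ | ⟨hR, hN⟩⟩
  · exact (unsolvableOn_of_mem_obstructionPatterns hp hR hN).unsolvable
  · have := (unsolvableOn_of_mem_obstructionPatterns hp hR hN).reflect
    rw [reflectSlots_reflectSlots] at this
    exact this.unsolvable

theorem solvableOn_of_subset_fourForms {S : Finset Slot} (n : Fin 4)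
    (h : S ⊆ (fourForms n).2.slots) : SolvableOn S := by
  fin_cases n
  · exact solvableOn_of_subset_formA h
  · exact solvableOn_of_subset_formB h
  · exact solvableOn_of_subset_formC h
  · exact solvableOn_of_subset_formD h

theorem GeneratedBy.solvable {k : ℕ} {F : Form k} {n : Fin 4}
    (h : GeneratedBy (fourForms n).2 k F) : Solvable F := by
  rcases generatedBy_iff.1 h with h | h
  · exact (solvableOn_of_subset_fourForms n h).solvable
  · have h' : reflectSlots F.slots ⊆ (fourForms n).2.slots := by
      rw [← reflectSlots_reflectSlots (fourForms n).2.slots]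
      exact Finset.image_subset_image h
    have := (solvableOn_of_subset_fourForms n h').reflect
    rw [reflectSlots_reflectSlots] at this
    exact this.solvable

theorem not_generatedBy_of_ne : ∀ m n : Fin 4, m ≠ n →
    ¬ GeneratedBy (fourForms m).2 (fourForms n).1 (fourForms n).2 := by
  simp only [generatedBy_iff]
  decide +kernel

/-- Adding a slot to one of the four forms leads out of the slots of all four forms and of their
reflections. -/
theorem insert_slot_not_subset : ∀ (n : Fin 4) (s : Slot), s ∉ (fourForms n).2.slots →
    ¬ ∃ m, insert s (fourForms n).2.slots ⊆ (fourForms m).2.slots ∨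
      insert s (fourForms n).2.slots ⊆ reflectSlots (fourForms m).2.slots := by
  decide +kernel

theorem AddsVariable.unsolvable {n : Fin 4} {G : Form ((fourForms n).1 + 1)}
    (h : AddsVariable (fourForms n).2 G) : Unsolvable G := by
  refine (exists_generatedBy_or_unsolvable G).resolve_left ?_
  have hnew : G (Fin.last _) ∉ (fourForms n).2.slots := by
    rw [Form.mem_slots]
    rintro ⟨a, ha⟩
    rw [← h a] at ha
    exact (Fin.castSucc_lt_last a).ne (G.injective ha)
  have hslots : G.slots = insert (G (Fin.last _)) (fourForms n).2.slots := by
    ext s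
    simp only [Form.mem_slots, Finset.mem_insert, Fin.exists_fin_succ', h _, eq_comm]
    exact or_comm
  simp only [generatedBy_iff, hslots]
  exact insert_slot_not_subset n _ hnew

end Tetra

theorem theorem3p1 :
    -- each of `A`, `B`, `C`, `D` generates a solution
    (∀ n : Fin 4, Tetra.Solvable (Tetra.fourForms n).2) ∧
    -- the solvable forms are exactly those which arise from `A`, `B`, `C`, `D`
    (∀ (k : ℕ) (F : Tetra.Form k), Tetra.Solvable F ↔
      ∃ n : Fin 4, Tetra.GeneratedBy (Tetra.fourForms n).2 k F) ∧
    -- for every other form there is no solution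
    (∀ (k : ℕ) (F : Tetra.Form k),
      (¬ ∃ n : Fin 4, Tetra.GeneratedBy (Tetra.fourForms n).2 k F) → Tetra.Unsolvable F) ∧
    -- `A`, `B`, `C`, `D` are essentially different
    (∀ m n : Fin 4, m ≠ n →
      ¬ Tetra.GeneratedBy (Tetra.fourForms m).2 (Tetra.fourForms n).1 (Tetra.fourForms n).2) ∧
    -- a free variable in any zero slot of `A`, `B`, `C`, `D` destroys solvability
    (∀ (n : Fin 4) (G : Tetra.Form ((Tetra.fourForms n).1 + 1)),
      Tetra.AddsVariable (Tetra.fourForms n).2 G → Tetra.Unsolvable G) := by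
  refine ⟨fun n => Tetra.GeneratedBy.solvable (n := n) .self,
    fun k F => ⟨fun h => ?_, fun ⟨n, h⟩ => h.solvable⟩,
    fun k F h => (Tetra.exists_generatedBy_or_unsolvable F).resolve_left h,
    Tetra.not_generatedBy_of_ne, fun n G h => h.unsolvable⟩
  exact (Tetra.exists_generatedBy_or_unsolvable F).resolve_right fun hu => hu.not_solvable h
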